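/- Theorem (after Simon). Let $V:\mathbb R\to\mathbb R$ satisfy $V\in L^1(\mathbb R)$, $V\le 0$ almost everywhere, $V\neq 0$ (that is, $V$ does not vanish almost everywhere), and $\int_{\mathbb R}(1+x^2)\,|V(x)|\,dx<\infty$. For $\lambda>0$ let $H_\lambda=-\partial_x^2+\lambda V$ be the Schrödinger operator on $L^2(\mathbb R)$ (complex-valued functions) with domain $\{\psi\in L^2(\mathbb R): H_\lambda\psi\in L^2(\mathbb R)\}$, where $H_\lambda\psi=-\psi''+\lambda V\psi$ is taken in the sense of distributions (in particular, $V\psi$ is required to be locally integrable). Then there is $\lambda_0>0$ such that for every $\lambda\in(0,\lambda_0)$ the operator $H_\lambda$ has exactly one eigenvalue $E_\lambda\in\mathbb R$, counted with multiplicity (that is, the point spectrum of $H_\lambda$ is $\{E_\lambda\}$ and the eigenspace is one-dimensional), and $$E_\lambda=-\frac{\lambda^2}{4}\Big(\int_{\mathbb R}|V(x)|\,dx\Big)^2+O(\lambda^3)\qquad(\lambda\to0^+),$$ where the implied constant may depend on $V$. -/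

import Mathlib

open MeasureTheory Filter Topology
open scoped ContDiff

namespace Schrodinger

/-- The Hilbert space `L²(ℝ)` of complex-valued square integrable functions. -/
abbrev L2R : Type := Lp ℂ 2 (volume : Measure ℝ)

/-- `f = -ψ'' + V ψ` in the sense of distributions on `ℝ`: the product `V ψ` is locally integrable
(so that it is a distribution) and the identity holds when tested against every smooth
compactly supported function `φ`. (Real-valued `φ` suffice, by complex linearity.) -/
def IsWeakImage (V : ℝ → ℝ) (ψ f : ℝ → ℂ) : Prop :=
  LocallyIntegrable (fun x => (V x : ℂ) * ψ x) volume ∧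
    ∀ φ : ℝ → ℝ, ContDiff ℝ ∞ φ → HasCompactSupport φ →
      -(∫ x, iteratedDeriv 2 φ x • ψ x) + ∫ x, φ x • ((V x : ℂ) * ψ x) = ∫ x, φ x • f x

theorem L2R.locallyIntegrable (ψ : L2R) : LocallyIntegrable (ψ : ℝ → ℂ) volume :=
  (Lp.memLp ψ).locallyIntegrable (by norm_num)

theorem integrable_smul_test {g : ℝ → ℂ} (hg : LocallyIntegrable g volume) {φ : ℝ → ℝ}
    (hφ : ContDiff ℝ ∞ φ) (hc : HasCompactSupport φ) :
    Integrable (fun x => φ x • g x) volume :=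
  hg.integrable_smul_left_of_hasCompactSupport hφ.continuous hc

theorem integrable_smul_test₂ {g : ℝ → ℂ} (hg : LocallyIntegrable g volume) {φ : ℝ → ℝ}
    (hφ : ContDiff ℝ ∞ φ) (hc : HasCompactSupport φ) :
    Integrable (fun x => iteratedDeriv 2 φ x • g x) volume := by
  have h2 : iteratedDeriv 2 φ = deriv (deriv φ) := by
    rw [iteratedDeriv_succ, iteratedDeriv_one]
  refine hg.integrable_smul_left_of_hasCompactSupport ?_ ?_
  · exact hφ.continuous_iteratedDeriv 2 (WithTop.coe_le_coe.2 le_top)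
  · rw [h2]
    exact hc.deriv.deriv

theorem IsWeakImage.congr {V : ℝ → ℝ} {ψ ψ' f f' : ℝ → ℂ} (h : IsWeakImage V ψ f)
    (hψ : ψ =ᵐ[volume] ψ') (hf : f =ᵐ[volume] f') : IsWeakImage V ψ' f' := by
  have hV : (fun x => (V x : ℂ) * ψ x) =ᵐ[volume] fun x => (V x : ℂ) * ψ' x := by
    filter_upwards [hψ] with x hx
    rw [hx]
  refine ⟨(locallyIntegrable_congr hV).1 h.1, fun φ hφ hc => ?_⟩
  have e1 : ∫ x, iteratedDeriv 2 φ x • ψ' x = ∫ x, iteratedDeriv 2 φ x • ψ x :=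
    integral_congr_ae (by filter_upwards [hψ] with x hx; rw [hx])
  have e2 : ∫ x, φ x • ((V x : ℂ) * ψ' x) = ∫ x, φ x • ((V x : ℂ) * ψ x) :=
    integral_congr_ae (by filter_upwards [hψ] with x hx; rw [hx])
  have e3 : ∫ x, φ x • f' x = ∫ x, φ x • f x :=
    integral_congr_ae (by filter_upwards [hf] with x hx; rw [hx])
  rw [e1, e2, e3]
  exact h.2 φ hφ hc

theorem IsWeakImage.add {V : ℝ → ℝ} {ψ₁ ψ₂ f₁ f₂ : ℝ → ℂ}
    (hψ₁ : LocallyIntegrable ψ₁ volume) (hψ₂ : LocallyIntegrable ψ₂ volume)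
    (hf₁ : LocallyIntegrable f₁ volume) (hf₂ : LocallyIntegrable f₂ volume)
    (h₁ : IsWeakImage V ψ₁ f₁) (h₂ : IsWeakImage V ψ₂ f₂) :
    IsWeakImage V (ψ₁ + ψ₂) (f₁ + f₂) := by
  refine ⟨?_, fun φ hφ hc => ?_⟩
  · have := h₁.1.add h₂.1
    refine (locallyIntegrable_congr (Eventually.of_forall fun x => ?_)).1 this
    simp [mul_add]
  · simp only [Pi.add_apply, mul_add, smul_add]
    rw [integral_add (integrable_smul_test₂ hψ₁ hφ hc) (integrable_smul_test₂ hψ₂ hφ hc),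
      integral_add (integrable_smul_test h₁.1 hφ hc) (integrable_smul_test h₂.1 hφ hc),
      integral_add (integrable_smul_test hf₁ hφ hc) (integrable_smul_test hf₂ hφ hc),
      ← h₁.2 φ hφ hc, ← h₂.2 φ hφ hc]
    ring

theorem IsWeakImage.smul {V : ℝ → ℝ} {ψ f : ℝ → ℂ} (c : ℂ) (h : IsWeakImage V ψ f) :
    IsWeakImage V (c • ψ) (c • f) := by
  refine ⟨?_, fun φ hφ hc => ?_⟩
  · have := h.1.smul c
    refine (locallyIntegrable_congr (Eventually.of_forall fun x => ?_)).1 this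
    simp [mul_left_comm]
  · have key : ∀ (r : ℝ → ℝ) (g : ℝ → ℂ), ∫ x, r x • (c * g x) = c * ∫ x, r x • g x := by
      intro r g
      rw [← integral_const_mul]
      refine integral_congr_ae (Eventually.of_forall fun x => ?_)
      simp [mul_left_comm]
    simp only [Pi.smul_apply, smul_eq_mul, mul_left_comm _ c]
    rw [key, key, key, ← h.2 φ hφ hc]
    ring

/-- The graph of the operator `-∂ₓ² + V` on `L²(ℝ)` with its natural domain: all pairs `(ψ, f)` of
square integrable functions with `f = -ψ'' + V ψ` in the sense of distributions. -/
def graph (V : ℝ → ℝ) : Submodule ℂ (L2R × L2R) where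
  carrier := {p | IsWeakImage V p.1 p.2}
  zero_mem' := by
    have h0 : IsWeakImage V 0 0 := by
      refine ⟨?_, fun φ _ _ => by simp⟩
      simpa using (locallyIntegrable_zero : LocallyIntegrable (fun _ : ℝ => (0 : ℂ)) volume)
    exact h0.congr (Lp.coeFn_zero ..).symm (Lp.coeFn_zero ..).symm
  add_mem' := by
    intro p q hp hq
    exact (IsWeakImage.add p.1.locallyIntegrable q.1.locallyIntegrable p.2.locallyIntegrable
      q.2.locallyIntegrable hp hq).congr (Lp.coeFn_add ..).symm (Lp.coeFn_add ..).symm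
  smul_mem' := by
    intro c p hp
    exact (IsWeakImage.smul c hp).congr (Lp.coeFn_smul ..).symm (Lp.coeFn_smul ..).symm

theorem mem_graph_iff {V : ℝ → ℝ} {ψ f : L2R} : (ψ, f) ∈ graph V ↔ IsWeakImage V ψ f := Iff.rfl

/-- The graph is single-valued. -/
theorem graph_snd_eq_zero (V : ℝ → ℝ) (p : L2R × L2R) (hp : p ∈ graph V) (h0 : p.1 = 0) :
    p.2 = 0 := by
  obtain ⟨ψ, f⟩ := p
  simp only at h0
  subst h0
  have h : IsWeakImage V 0 f := IsWeakImage.congr hp (Lp.coeFn_zero ..) EventuallyEq.rfl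
  have hf : ∀ᵐ x ∂volume, f x = 0 := by
    refine ae_eq_zero_of_integral_contDiff_smul_eq_zero f.locallyIntegrable fun φ hφ hc => ?_
    rw [← h.2 φ hφ hc]
    simp
  exact Lp.ext (by filter_upwards [hf, Lp.coeFn_zero ℂ 2 (volume : Measure ℝ)] with x h1 h2
                   rw [h1, h2]; rfl)

/-- The Schrödinger operator `H = -∂ₓ² + V` on `L²(ℝ)`, with domain
`{ψ ∈ L²(ℝ) | H ψ ∈ L²(ℝ)}`, where `H ψ` is understood in the sense of distributions. -/
noncomputable def schrodingerOperator (V : ℝ → ℝ) : L2R →ₗ.[ℂ] L2R :=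
  (graph V).toLinearPMap

/-- The operator is determined by its graph, as intended: `ψ` is in the domain with image `f` iff
`-ψ'' + V ψ = f` in the sense of distributions. -/
theorem exists_schrodingerOperator_apply_eq_iff {V : ℝ → ℝ} {ψ f : L2R} :
    (∃ h : ψ ∈ (schrodingerOperator V).domain, schrodingerOperator V ⟨ψ, h⟩ = f) ↔
      IsWeakImage V ψ f := by
  rw [← mem_graph_iff, ← Submodule.toLinearPMap_graph_eq (graph V) (graph_snd_eq_zero V),
    LinearPMap.mem_graph_iff]
  constructor
  · rintro ⟨h, e⟩
    exact ⟨⟨ψ, h⟩, rfl, e⟩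
  · rintro ⟨y, hy, e⟩
    simp only at hy e
    subst hy
    exact ⟨y.2, e⟩

section PointSpectrum

variable {H : Type*} [AddCommGroup H] [Module ℂ H]

/-- The operator `T - z`, defined on the domain of `T`. -/
def subScalar (T : H →ₗ.[ℂ] H) (z : ℂ) : T.domain →ₗ[ℂ] H :=
  T.toFun - z • T.domain.subtype

/-- The point spectrum (set of eigenvalues) of an unbounded operator: all `z ∈ ℂ` such that `T - z`
is not injective on the domain of `T`. -/
def pointSpectrum (T : H →ₗ.[ℂ] H) : Set ℂ :=
  {z | ¬ Function.Injective (subScalar T z)}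

/-- The multiplicity of `z` as an eigenvalue of `T`: the dimension of the kernel of `T - z`. -/
noncomputable def multiplicity (T : H →ₗ.[ℂ] H) (z : ℂ) : Cardinal :=
  Module.rank ℂ (LinearMap.ker (subScalar T z))

end PointSpectrum

end Schrodinger

/-! Write `W = |V|` and look for eigenvalues `-κ²` with `Re κ ≥ 0`. The free resolvent has kernel
`exp(-κ|x-y|)/(2κ)`, so for `Re κ > 0` an eigenfunction satisfies `f = λ/(2κ) ∫ W f + λ K f`, where
`K` (`regularOp`) comes from the kernel with its singular part `1/(2κ)` removed. The remaining
kernel is at most `|x-y|/2`, uniformly in `κ`, so `K` is bounded on continuous functions of growth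
`O(1+|x|)`, with norm controlled by `∫ (1+|x|)² W`. For small `λ`, `∫ W f = 0` would give `f = λ K
f` and hence `f = 0`. So every such eigenfunction can be scaled to solve `u = 1 + λ K u` with `κ =
(λ/2) ∫ W u`.

Reading the last formula as a definition of `κ` in terms of `u` leaves one nonlinear fixed point
equation for `u`. It is a contraction near the constant `1` (`IsSmall.dist_fixedPointMap_le`): the
Lipschitz constant of the kernel in `κ` is of order `1/λ`, but `κ` depends on `u` through a factor
`λ`, and the `λ` in front of `K` remains to spare. Uniqueness of the fixed point gives at once a
single eigenvalue, its simplicity and, by complex conjugation, the reality of `κ`. As `u = 1 + O(λ)`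
in the weighted norm, `κ = (λ/2) ∫ W + O(λ²)`, and squaring gives the expansion.

It remains to match fixed points with eigenfunctions. A weak eigenfunction in `L²` has a regular
representative (`exists_regular_representative`) which is bounded (`exists_norm_le_of_solution`),
and `integral_exp_abs_mul` supplies its integral equation; imaginary `κ` is excluded by a Volterra
equation from infinity (`eq_zero_of_re_eq_zero`). Conversely a fixed point is square integrable, and
it solves the equation weakly by Fubini and the resolvent formula for test functions
(`IsNormalizedSolution.isWeakImage`). -/

namespace Schrodinger

/-! ### Primitives, integration by parts and Green's identity -/

/-- `g` is a primitive of the locally integrable function `h`. -/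
structure IsPrimitive (g h : ℝ → ℂ) : Prop where
  intervalIntegrable : ∀ a b, IntervalIntegrable h volume a b
  sub_eq : ∀ a b, g b - g a = ∫ x in a..b, h x

theorem IsPrimitive.continuous {g h : ℝ → ℂ} (hg : IsPrimitive g h) : Continuous g := by
  have e : g = fun x => g 0 + ∫ t in (0 : ℝ)..x, h t := by
    funext x; rw [← hg.sub_eq]; ring
  rw [e]
  exact continuous_const.add (intervalIntegral.continuous_primitive hg.intervalIntegrable 0)

theorem isPrimitive_integral {h : ℝ → ℂ} (hh : LocallyIntegrable h volume) :
    IsPrimitive (fun x => ∫ t in (0 : ℝ)..x, h t) h := by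
  have hi : ∀ a b, IntervalIntegrable h volume a b := fun a b =>
    (hh.integrableOn_isCompact isCompact_uIcc).intervalIntegrable
  exact ⟨hi, fun a b => intervalIntegral.integral_interval_sub_left (hi 0 b) (hi 0 a)⟩

/-- Fubini on the triangle `t ≤ x` in the square over `(a, b]`. -/
theorem intervalIntegral_mul_primitive {m' h : ℝ → ℂ} {a b : ℝ} (hab : a ≤ b)
    (hm' : IntervalIntegrable m' volume a b) (hh : IntervalIntegrable h volume a b) :
    ∫ x in a..b, m' x * ∫ t in a..x, h t = ∫ t in a..b, (∫ x in t..b, m' x) * h t := by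
  have h1 := (intervalIntegrable_iff_integrableOn_Ioc_of_le hab).1 hm'
  have h2 := (intervalIntegrable_iff_integrableOn_Ioc_of_le hab).1 hh
  have hF : Integrable (Function.uncurry fun x t : ℝ => if t ≤ x then m' x * h t else 0)
      ((volume.restrict (Set.Ioc a b)).prod (volume.restrict (Set.Ioc a b))) := by
    have := (h1.mul_prod h2).indicator
      (s := {p : ℝ × ℝ | p.2 ≤ p.1}) (measurableSet_le measurable_snd measurable_fst)
    refine this.congr (Eventually.of_forall fun p => ?_)
    simp [Set.indicator_apply, Function.uncurry]
  have key := integral_integral_swap hF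
  rw [intervalIntegral.integral_of_le hab, intervalIntegral.integral_of_le hab]
  convert key using 1
  · refine setIntegral_congr_fun measurableSet_Ioc fun x hx => ?_
    rw [intervalIntegral.integral_of_le hx.1.le, ← integral_const_mul,
      ← integral_indicator measurableSet_Ioc, ← integral_indicator measurableSet_Ioc]
    congr 1; funext t
    simp only [Set.indicator_apply, Set.mem_Ioc]
    have := hx.2
    by_cases h3 : a < t <;> by_cases h4 : t ≤ x <;> simp [h3, h4]
    intro h5; linarith
  · refine setIntegral_congr_ae measurableSet_Ioc ?_
    -- The section of the triangle is `[t, b]`, while the interval integral runs over `(t, b]`; the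
    -- point `t` is null.
    have hne : ∀ t : ℝ, ∀ᵐ x ∂(volume : Measure ℝ), x ≠ t := fun t => by
      simp [ae_iff]
    refine Eventually.of_forall fun t ht => ?_
    rw [intervalIntegral.integral_of_le ht.2, ← integral_mul_const,
      ← integral_indicator measurableSet_Ioc, ← integral_indicator measurableSet_Ioc]
    refine integral_congr_ae ?_
    filter_upwards [hne t] with x hx
    simp only [Set.indicator_apply, Set.mem_Ioc]
    have := ht.1
    by_cases h3 : t < x <;> by_cases h4 : x ≤ b
    · simp [h3, h4, h3.le, this.trans h3]
    · simp [h4]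
    · have : ¬ t ≤ x := fun h => h3 (lt_of_le_of_ne h (Ne.symm hx))
      simp [h3, this]
    · simp [h4]

/-- Integration by parts with `g` merely absolutely continuous, read off from Fubini on the triangle
for `m'` and `h`. -/
theorem IsPrimitive.integral_mul_eq {m m' g h : ℝ → ℂ} {a b : ℝ} (hab : a ≤ b)
    (hm : ∀ x, HasDerivAt m (m' x) x) (hm' : Continuous m') (hg : IsPrimitive g h) :
    ∫ x in a..b, m x * h x = m b * g b - m a * g a - ∫ x in a..b, m' x * g x := by
  have hmc : Continuous m := continuous_iff_continuousAt.2 fun x => (hm x).continuousAt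
  have hi := hg.intervalIntegrable a b
  have hmi := hm'.intervalIntegrable (μ := volume) a b
  have e1 : ∀ t, ∫ x in t..b, m' x = m b - m t := fun t =>
    intervalIntegral.integral_eq_sub_of_hasDerivAt (fun x _ => hm x) (hm'.intervalIntegrable _ _)
  have key := intervalIntegral_mul_primitive hab hmi hi
  simp only [e1, ← hg.sub_eq, sub_mul, mul_sub] at key
  rw [intervalIntegral.integral_sub, intervalIntegral.integral_sub,
    intervalIntegral.integral_mul_const, intervalIntegral.integral_const_mul, e1,
    ← hg.sub_eq] at key
  · linear_combination key
  · exact hi.const_mul _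
  · exact hi.continuousOn_mul hmc.continuousOn
  · exact (hm'.mul hg.continuous).intervalIntegrable _ _
  · exact hmi.mul_const _

/-- A multiplier `m` with suitable values at the end points isolates `f` or `g` at one point; the
later estimates on solutions arise in this way. -/
theorem IsPrimitive.green {m m' m'' f g h : ℝ → ℂ} {a b : ℝ} (hab : a ≤ b)
    (hm : ∀ x, HasDerivAt m (m' x) x) (hm' : ∀ x, HasDerivAt m' (m'' x) x) (hm'' : Continuous m'')
    (hf : ∀ x, HasDerivAt f (g x) x) (hg : IsPrimitive g h) :
    ∫ x in a..b, (m x * h x - m'' x * f x) =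
      (m b * g b - m' b * f b) - (m a * g a - m' a * f a) := by
  have hmc : Continuous m := continuous_iff_continuousAt.2 fun x => (hm x).continuousAt
  have hmc' : Continuous m' := continuous_iff_continuousAt.2 fun x => (hm' x).continuousAt
  have hfc : Continuous f := continuous_iff_continuousAt.2 fun x => (hf x).continuousAt
  have h1 := hg.integral_mul_eq hab hm hmc'
  have h2 := intervalIntegral.integral_mul_deriv_eq_deriv_mul (a := a) (b := b)
    (fun x _ => hm' x) (fun x _ => hf x) (hm''.intervalIntegrable _ _)
    (hg.continuous.intervalIntegrable _ _)
  rw [intervalIntegral.integral_sub ((hg.intervalIntegrable a b).continuousOn_mul hmc.continuousOn)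
    (show IntervalIntegrable (fun x => m'' x * f x) volume a b from
      (hm''.mul hfc).intervalIntegrable _ _), h1, h2]
  ring

/-! ### Test functions and regularity of weak solutions -/

theorem exists_support_subset_Ioc {φ : ℝ → ℝ} (hc : HasCompactSupport φ) :
    ∃ a b, a ≤ b ∧ φ a = 0 ∧ φ b = 0 ∧ Function.support φ ⊆ Set.Ioc a b ∧
      Function.support (deriv φ) ⊆ Set.Ioc a b := by
  obtain ⟨r, hr⟩ := hc.isCompact.isBounded.subset_closedBall (0 : ℝ)
  have hz : ∀ x, r < |x| → x ∉ tsupport φ := fun x hx h => by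
    have := hr h
    rw [Metric.mem_closedBall, Real.dist_eq, sub_zero] at this
    linarith
  have hs : tsupport φ ⊆ Set.Ioc (-(|r| + 1)) (|r| + 1) := fun x hx => by
    have := hr hx
    rw [Metric.mem_closedBall, Real.dist_eq, sub_zero, abs_le] at this
    have := le_abs_self r
    constructor <;> linarith
  have hpos := abs_nonneg r
  have hle := le_abs_self r
  refine ⟨-(|r| + 1), |r| + 1, by linarith, image_eq_zero_of_notMem_tsupport (hz _ ?_),
    image_eq_zero_of_notMem_tsupport (hz _ ?_), (subset_tsupport _).trans hs,
    support_deriv_subset.trans hs⟩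
  · rw [abs_neg, abs_of_pos] <;> linarith
  · rw [abs_of_pos] <;> linarith

theorem IsPrimitive.integral_deriv_smul {g h : ℝ → ℂ} (hg : IsPrimitive g h) {φ : ℝ → ℝ}
    (hφ : ContDiff ℝ ∞ φ) (hc : HasCompactSupport φ) :
    ∫ x, deriv φ x • g x = -∫ x, φ x • h x := by
  obtain ⟨a, b, hab, ha, hb, hs, hs'⟩ := exists_support_subset_Ioc hc
  have hd : ∀ x, HasDerivAt (fun x => (φ x : ℂ)) ((deriv φ x : ℝ) : ℂ) x := fun x =>
    ((hφ.differentiable (by simp)) x).hasDerivAt.ofReal_comp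
  have hdc : Continuous fun x => ((deriv φ x : ℝ) : ℂ) :=
    Complex.continuous_ofReal.comp (hφ.continuous_deriv (by simp))
  have := hg.integral_mul_eq hab hd hdc
  rw [ha, hb] at this
  have e : ∀ (r : ℝ → ℝ) (u : ℝ → ℂ), Function.support r ⊆ Set.Ioc a b →
      ∫ x, r x • u x = ∫ x in a..b, (r x : ℂ) * u x := fun r u hr =>
    (intervalIntegral.integral_eq_integral_of_support_subset
      (f := fun x => r x • u x) ((Function.support_smul_subset_left r u).trans hr)).symm
  rw [e _ _ hs', e _ _ hs, this]
  simp

theorem exists_test_integral_eq_one :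
    ∃ ρ : ℝ → ℝ, ContDiff ℝ ∞ ρ ∧ HasCompactSupport ρ ∧ ∫ x, ρ x = 1 := by
  let b : ContDiffBump (0 : ℝ) := ⟨1, 2, one_pos, one_lt_two⟩
  exact ⟨b.normed volume, b.contDiff_normed, b.hasCompactSupport_normed, b.integral_normed⟩

/-- The primitive from the left end of the support vanishes to the left of it, and to the right
because the total integral is zero. -/
theorem exists_test_primitive {η : ℝ → ℝ} (hη : ContDiff ℝ ∞ η) (hc : HasCompactSupport η)
    (h0 : ∫ x, η x = 0) :
    ∃ φ : ℝ → ℝ, ContDiff ℝ ∞ φ ∧ HasCompactSupport φ ∧ deriv φ = η := by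
  obtain ⟨a, b, hab, -, -, hs, -⟩ := exists_support_subset_Ioc hc
  have hi : ∀ c d, IntervalIntegrable η volume c d := fun c d =>
    hη.continuous.intervalIntegrable _ _
  have hd : ∀ x, HasDerivAt (fun x => ∫ t in a..x, η t) (η x) x := fun x =>
    intervalIntegral.integral_hasDerivAt_right (hi _ _)
      (hη.continuous.stronglyMeasurableAtFilter _ _) hη.continuous.continuousAt
  have hde : deriv (fun x => ∫ t in a..x, η t) = η := funext fun x => (hd x).deriv
  have hz : ∀ t, t ∉ Set.Ioc a b → η t = 0 := fun t ht => by
    by_contra h; exact ht (hs h)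
  refine ⟨fun x => ∫ t in a..x, η t, ?_, ?_, hde⟩
  · rw [contDiff_infty_iff_deriv, hde]
    exact ⟨fun x => (hd x).differentiableAt, hη⟩
  · refine HasCompactSupport.intro (K := Set.Icc a b) isCompact_Icc fun x hx => ?_
    rw [Set.mem_Icc, not_and_or, not_le, not_le] at hx
    rcases hx with hx | hx
    · refine intervalIntegral.integral_zero_ae (Eventually.of_forall fun t ht => hz t fun h => ?_)
      rw [Set.uIoc_of_ge hx.le] at ht
      exact absurd h.1 (not_lt.2 ht.2)
    · rw [intervalIntegral.integral_eq_integral_of_support_subset, h0]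
      exact hs.trans (Set.Ioc_subset_Ioc_right hx.le)

/-- **The lemma of du Bois-Reymond**: a weak primitive is a primitive up to a constant. -/
theorem ae_eq_of_forall_integral_deriv_smul {ψ g h : ℝ → ℂ} (hψ : LocallyIntegrable ψ volume)
    (hg : IsPrimitive g h) (hw : ∃ c : ℂ, ∀ η : ℝ → ℝ, ContDiff ℝ ∞ η → HasCompactSupport η →
      ∫ x, η x • ψ x = (∫ x, η x) • c + ∫ x, η x • g x) :
    ∃ c : ℂ, ψ =ᵐ[volume] fun x => g x + c := by
  obtain ⟨c, hw⟩ := hw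
  refine ⟨c, ?_⟩
  have hgc : LocallyIntegrable (fun x => g x + c) volume :=
    (hg.continuous.add continuous_const).locallyIntegrable
  refine ae_eq_of_integral_contDiff_smul_eq hψ hgc fun η hη hc => ?_
  rw [hw η hη hc]
  simp only [smul_add]
  rw [integral_add (integrable_smul_test hg.continuous.locallyIntegrable hη hc)
    (integrable_smul_test (locallyIntegrable_const c) hη hc), integral_smul_const, add_comm]

/-- Subtracting `(∫ η) ρ` from `η` leaves a test function of mean zero, hence a derivative, on which
`ψ` and `g` agree. So `ψ - g` acts as a constant, namely its value on `ρ`. -/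
theorem exists_integral_smul_eq_of_forall_deriv {ψ g : ℝ → ℂ} (hψ : LocallyIntegrable ψ volume)
    (hg : LocallyIntegrable g volume)
    (h : ∀ φ : ℝ → ℝ, ContDiff ℝ ∞ φ → HasCompactSupport φ →
      ∫ x, deriv φ x • ψ x = ∫ x, deriv φ x • g x) :
    ∃ c : ℂ, ∀ η : ℝ → ℝ, ContDiff ℝ ∞ η → HasCompactSupport η →
      ∫ x, η x • ψ x = (∫ x, η x) • c + ∫ x, η x • g x := by
  obtain ⟨ρ, hρ, hρc, hρ1⟩ := exists_test_integral_eq_one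
  refine ⟨(∫ x, ρ x • ψ x) - ∫ x, ρ x • g x, fun η hη hc => ?_⟩
  have hηi : Integrable η := hη.continuous.integrable_of_hasCompactSupport hc
  have hρi : Integrable ρ := hρ.continuous.integrable_of_hasCompactSupport hρc
  set I := ∫ x, η x
  have hcρ : HasCompactSupport (fun x => I * ρ x) := hρc.mul_left
  obtain ⟨φ, hφ, hφc, hφd⟩ := exists_test_primitive (η := fun x => η x - I * ρ x)
    (hη.sub (contDiff_const.mul hρ)) (hc.sub hcρ) (by
      rw [integral_sub hηi (hρi.const_mul _), integral_const_mul, hρ1]; simp [I])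
  have key := h φ hφ hφc
  have split : ∀ u : ℝ → ℂ, LocallyIntegrable u volume →
      ∫ x, deriv φ x • u x = (∫ x, η x • u x) - I • ∫ x, ρ x • u x := fun u hu => by
    simp only [hφd, sub_smul, mul_smul]
    rw [integral_sub (integrable_smul_test hu hη hc)
      (show Integrable (fun x => I • ρ x • u x) from (integrable_smul_test hu hρ hρc).smul I),
      integral_smul]
  rw [split ψ hψ, split g hg] at key
  rw [smul_sub]
  linear_combination key

/-- A locally integrable function whose second distributional derivative is locally integrable
has a representative with absolutely continuous derivative. -/
theorem exists_regular_representative {ψ h : ℝ → ℂ} (hψ : LocallyIntegrable ψ volume)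
    (hh : LocallyIntegrable h volume)
    (hw : ∀ φ : ℝ → ℝ, ContDiff ℝ ∞ φ → HasCompactSupport φ →
      ∫ x, iteratedDeriv 2 φ x • ψ x = ∫ x, φ x • h x) :
    ∃ f g : ℝ → ℂ, ψ =ᵐ[volume] f ∧ (∀ x, HasDerivAt f (g x) x) ∧ IsPrimitive g h := by
  obtain ⟨ρ, hρ, hρc, hρ1⟩ := exists_test_integral_eq_one
  set G : ℝ → ℂ := fun x => ∫ t in (0 : ℝ)..x, h t
  have hG : IsPrimitive G h := isPrimitive_integral hh
  set F : ℝ → ℂ := fun x => ∫ t in (0 : ℝ)..x, G t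
  have hF : IsPrimitive F G := isPrimitive_integral hG.continuous.locallyIntegrable
  have hFl := hF.continuous.locallyIntegrable (μ := volume)
  have h2 : ∀ φ : ℝ → ℝ, iteratedDeriv 2 φ = deriv (deriv φ) := fun φ => by
    rw [iteratedDeriv_succ, iteratedDeriv_one]
  have hd : ∀ φ : ℝ → ℝ, ContDiff ℝ ∞ φ → ContDiff ℝ ∞ (deriv φ) := fun φ hφ =>
    (contDiff_infty_iff_deriv.1 hφ).2
  have step : ∀ φ : ℝ → ℝ, ContDiff ℝ ∞ φ → HasCompactSupport φ →
      ∫ x, deriv (deriv φ) x • ψ x = ∫ x, deriv (deriv φ) x • F x := fun φ hφ hc => by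
    rw [hF.integral_deriv_smul (hd φ hφ) hc.deriv, hG.integral_deriv_smul hφ hc, neg_neg, ← h2]
    exact hw φ hφ hc
  -- Minus the distributional derivative of `ψ - F`. It vanishes on derivatives of test functions by
  -- `step`, so it is a constant.
  set D : (ℝ → ℝ) → ℂ := fun φ => (∫ x, deriv φ x • ψ x) - ∫ x, deriv φ x • F x
  obtain ⟨c, hc⟩ : ∃ c : ℂ, ∀ η : ℝ → ℝ, ContDiff ℝ ∞ η → HasCompactSupport η →
      D η = (∫ x, η x) • c := by
    refine ⟨D ρ, fun η hη hc => ?_⟩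
    have hηi : Integrable η := hη.continuous.integrable_of_hasCompactSupport hc
    have hρi : Integrable ρ := hρ.continuous.integrable_of_hasCompactSupport hρc
    set I := ∫ x, η x
    have hcρ : HasCompactSupport (fun x => I * ρ x) := hρc.mul_left
    obtain ⟨φ, hφ, hφc, hφd⟩ := exists_test_primitive (η := fun x => η x - I * ρ x)
      (hη.sub (contDiff_const.mul hρ)) (hc.sub hcρ) (by
        rw [integral_sub hηi (hρi.const_mul _), integral_const_mul, hρ1]; simp [I])
    have key := step φ hφ hφc
    have hde : ∀ x, deriv (deriv φ) x = deriv η x - I * deriv ρ x := fun x => by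
      rw [hφd]
      have e1 := ((hη.differentiable (by simp)) x).hasDerivAt
      have e2 := ((hρ.differentiable (by simp)) x).hasDerivAt
      exact (e1.sub (e2.const_mul I)).deriv
    have split : ∀ u : ℝ → ℂ, LocallyIntegrable u volume →
        ∫ x, deriv (deriv φ) x • u x = (∫ x, deriv η x • u x) - I • ∫ x, deriv ρ x • u x :=
      fun u hu => by
        simp only [hde, sub_smul, mul_smul]
        rw [integral_sub (integrable_smul_test hu (hd η hη) hc.deriv)
          (show Integrable (fun x => I • deriv ρ x • u x) from
            (integrable_smul_test hu (hd ρ hρ) hρc.deriv).smul I), integral_smul]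
    rw [split ψ hψ, split F hFl] at key
    simp only [D, smul_sub]
    linear_combination key
  -- The constant found for `D` says `(ψ - F)' = -c`, so `ψ` and `F - x c` have the same
  -- distributional derivative.
  have hlin : IsPrimitive (fun x => F x - x * c) (fun x => G x - c) := by
    refine ⟨fun a b => (hF.intervalIntegrable a b).sub intervalIntegrable_const, fun a b => ?_⟩
    rw [intervalIntegral.integral_sub (hF.intervalIntegrable a b) intervalIntegrable_const,
      ← hF.sub_eq, intervalIntegral.integral_const, Complex.real_smul]
    push_cast; ring
  have hlinc : ∀ φ : ℝ → ℝ, ContDiff ℝ ∞ φ → HasCompactSupport φ →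
      ∫ x, deriv φ x • ψ x = ∫ x, deriv φ x • (F x - x * c) := fun φ hφ hφc => by
    have e := hc φ hφ hφc
    rw [hlin.integral_deriv_smul hφ hφc]
    simp only [smul_sub]
    rw [integral_sub (integrable_smul_test hG.continuous.locallyIntegrable hφ hφc)
      (integrable_smul_test (locallyIntegrable_const c) hφ hφc), integral_smul_const, ← e,
      neg_sub]
    simp only [D]
    rw [hF.integral_deriv_smul hφ hφc]; ring
  obtain ⟨c', hc'⟩ := ae_eq_of_forall_integral_deriv_smul hψ hlin
    (exists_integral_smul_eq_of_forall_deriv hψ hlin.continuous.locallyIntegrable hlinc)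
  refine ⟨_, fun x => G x - c, hc', fun x => ?_, hG.intervalIntegrable, fun a b => ?_⟩
  · have h1 : HasDerivAt F (G x) x := intervalIntegral.integral_hasDerivAt_right
      (hG.continuous.intervalIntegrable _ _)
      (hG.continuous.stronglyMeasurableAtFilter _ _) hG.continuous.continuousAt
    have h3 : HasDerivAt (fun x : ℝ => (x : ℂ) * c) (1 * c) x :=
      (Complex.ofRealCLM.hasDerivAt (x := x)).mul_const c
    simpa using (h1.sub h3).add_const c'
  · rw [← hG.sub_eq]; ring

/-! ### Boundedness of square integrable solutions -/

theorem IsPrimitive.comp_neg {g h : ℝ → ℂ} (hg : IsPrimitive g h) :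
    IsPrimitive (fun x => -g (-x)) (fun x => h (-x)) := by
  refine ⟨fun a b => ?_, fun a b => ?_⟩
  · rw [← neg_neg a, ← neg_neg b]
    exact (IntervalIntegrable.iff_comp_neg (by simp)).1 (hg.intervalIntegrable (-a) (-b))
  · rw [intervalIntegral.integral_comp_neg, ← hg.sub_eq]; ring

theorem hasDerivAt_comp_neg {f g : ℝ → ℂ} (hf : ∀ x, HasDerivAt f (g x) x) (x : ℝ) :
    HasDerivAt (fun x => f (-x)) (-g (-x)) x := by
  exact ((hf (-x)).scomp x (hasDerivAt_neg x)).congr_deriv (by simp)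

/-- Green's identity on `[x, x+1]` with `m = t (1-t)²`, `t = y - x`. Since `m` and `m'` vanish at `t
= 1`, while `m = 0` and `m' = 1` at `t = 0`, only `f x` survives; moreover `|m| ≤ 1` and `|m''| ≤
4`. -/
theorem norm_le_integral_add_one {f g h : ℝ → ℂ} (hf : ∀ x, HasDerivAt f (g x) x)
    (hg : IsPrimitive g h) (x : ℝ) :
    ‖f x‖ ≤ ∫ y in x..(x + 1), (‖h y‖ + 4 * ‖f y‖) := by
  have hfc : Continuous f := continuous_iff_continuousAt.2 fun x => (hf x).continuousAt
  have h1 : ∀ y : ℝ, HasDerivAt (fun y => y - x) 1 y := fun y => (hasDerivAt_id y).sub_const x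
  have hm : ∀ y : ℝ, HasDerivAt (fun y => (((y - x) * (1 - (y - x)) ^ 2 : ℝ) : ℂ))
      (((1 - (y - x)) ^ 2 - 2 * (y - x) * (1 - (y - x)) : ℝ) : ℂ) y := fun y => by
    refine HasDerivAt.ofReal_comp (((h1 y).mul (((h1 y).const_sub 1).pow 2)).congr_deriv ?_)
    simp; ring
  have hm' : ∀ y : ℝ, HasDerivAt
      (fun y => (((1 - (y - x)) ^ 2 - 2 * (y - x) * (1 - (y - x)) : ℝ) : ℂ))
      ((-4 + 6 * (y - x) : ℝ) : ℂ) y := fun y => by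
    refine HasDerivAt.ofReal_comp (((((h1 y).const_sub 1).pow 2).sub
      (((h1 y).const_mul 2).mul ((h1 y).const_sub 1))).congr_deriv ?_)
    simp; ring
  have key := hg.green (a := x) (b := x + 1) (by linarith) hm hm'
    (by fun_prop) hf
  have e : f x = ∫ y in x..(x + 1), ((((y - x) * (1 - (y - x)) ^ 2 : ℝ) : ℂ) * h y -
      ((-4 + 6 * (y - x) : ℝ) : ℂ) * f y) := by
    rw [key]; simp
  rw [e]
  refine intervalIntegral.norm_integral_le_of_norm_le (by linarith)
    (Eventually.of_forall fun y hy => ?_)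
    ((hg.intervalIntegrable _ _).norm.add ((hfc.norm.intervalIntegrable _ _).const_mul 4))
  have ht0 : 0 ≤ y - x := by linarith [hy.1]
  have ht1 : 0 ≤ 1 - (y - x) := by linarith [hy.2]
  refine (norm_sub_le _ _).trans (add_le_add ?_ ?_)
  · rw [norm_mul, Complex.norm_real, Real.norm_of_nonneg (by positivity)]
    refine mul_le_of_le_one_left (norm_nonneg _) ?_
    have : (1 - (y - x)) ^ 2 ≤ 1 := by nlinarith
    nlinarith [sq_nonneg (1 - (y - x))]
  · rw [norm_mul, Complex.norm_real]
    refine mul_le_mul_of_nonneg_right ?_ (norm_nonneg _)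
    rw [Real.norm_eq_abs, abs_le]
    constructor <;> linarith

section Solution

variable {f g : ℝ → ℂ} {w : ℝ → ℝ} {z : ℂ}

/-- The potential contributes at most `S ∫ w ≤ S / 2`, which can be absorbed at a maximum of `‖f‖`;
the rest is controlled by `‖f‖ ≤ 1 + ‖f‖²`. -/
theorem norm_le_of_forall_Icc_le (hf : ∀ x, HasDerivAt f (g x) x)
    (hg : IsPrimitive g fun y => (z - w y) * f y) (hf2 : Integrable fun x => ‖f x‖ ^ 2)
    (hw : Integrable w) (hw0 : ∀ x, 0 ≤ w x) (hw1 : ∫ x, w x ≤ 1 / 2) {x S : ℝ}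
    (hS : ∀ y ∈ Set.Icc x (x + 1), ‖f y‖ ≤ S) :
    ‖f x‖ ≤ S / 2 + (‖z‖ + 4) * (1 + ∫ y, ‖f y‖ ^ 2) := by
  have hfc : Continuous f := continuous_iff_continuousAt.2 fun x => (hf x).continuousAt
  have hS0 : 0 ≤ S := (norm_nonneg _).trans (hS x ⟨le_rfl, by linarith⟩)
  have hxx : x ≤ x + 1 := by linarith
  have i1 : IntervalIntegrable (fun y => S * w y) volume x (x + 1) :=
    (hw.const_mul S).intervalIntegrable
  have i2 : IntervalIntegrable (fun y => (‖z‖ + 4) * (1 + ‖f y‖ ^ 2)) volume x (x + 1) :=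
    Continuous.intervalIntegrable (by fun_prop) _ _
  refine (norm_le_integral_add_one hf hg x).trans ?_
  calc ∫ y in x..(x + 1), (‖(z - w y) * f y‖ + 4 * ‖f y‖)
      ≤ ∫ y in x..(x + 1), (S * w y + (‖z‖ + 4) * (1 + ‖f y‖ ^ 2)) := by
        refine intervalIntegral.integral_mono_on hxx
          ((hg.intervalIntegrable _ _).norm.add ((hfc.norm.intervalIntegrable _ _).const_mul 4))
          (i1.add i2) fun y hy => ?_
        have e1 : ‖(z - w y) * f y‖ ≤ (‖z‖ + w y) * ‖f y‖ := by
          rw [norm_mul]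
          refine mul_le_mul_of_nonneg_right ((norm_sub_le _ _).trans ?_) (norm_nonneg _)
          rw [Complex.norm_real, Real.norm_of_nonneg (hw0 y)]
        have e2 : w y * ‖f y‖ ≤ S * w y := by
          rw [mul_comm]; exact mul_le_mul_of_nonneg_right (hS y hy) (hw0 y)
        have e3 : ‖f y‖ ≤ 1 + ‖f y‖ ^ 2 := by nlinarith [sq_nonneg (‖f y‖ - 1), norm_nonneg (f y)]
        nlinarith [mul_le_mul_of_nonneg_left e3 (add_nonneg (norm_nonneg z) (by norm_num : (0:ℝ) ≤ 4))]
    _ = S * (∫ y in x..(x + 1), w y) +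
          (‖z‖ + 4) * (1 + ∫ y in x..(x + 1), ‖f y‖ ^ 2) := by
        rw [intervalIntegral.integral_add i1 i2, intervalIntegral.integral_const_mul,
          intervalIntegral.integral_const_mul, intervalIntegral.integral_add
            intervalIntegrable_const (hf2.intervalIntegrable)]
        simp
    _ ≤ S / 2 + (‖z‖ + 4) * (1 + ∫ y, ‖f y‖ ^ 2) := by
        have j1 : ∫ y in x..(x + 1), w y ≤ ∫ y, w y := by
          rw [intervalIntegral.integral_of_le hxx]
          exact setIntegral_le_integral hw (Eventually.of_forall hw0)
        have j2 : ∫ y in x..(x + 1), ‖f y‖ ^ 2 ≤ ∫ y, ‖f y‖ ^ 2 := by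
          rw [intervalIntegral.integral_of_le hxx]
          exact setIntegral_le_integral hf2 (Eventually.of_forall fun y => sq_nonneg _)
        have := norm_nonneg z
        gcongr
        nlinarith

/-- Square integrable solutions of `f'' = (z - w) f` are bounded when `∫ w` is small. -/
theorem exists_norm_le_of_solution (hf : ∀ x, HasDerivAt f (g x) x)
    (hg : IsPrimitive g fun y => (z - w y) * f y) (hf2 : Integrable fun x => ‖f x‖ ^ 2)
    (hw : Integrable w) (hw0 : ∀ x, 0 ≤ w x) (hw1 : ∫ x, w x ≤ 1 / 2) :
    ∃ C, ∀ x, ‖f x‖ ≤ C := by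
  have hfc : Continuous f := continuous_iff_continuousAt.2 fun x => (hf x).continuousAt
  refine ⟨2 * ((‖z‖ + 4) * (1 + ∫ y, ‖f y‖ ^ 2)), fun x => ?_⟩
  -- No global bound is known yet, so the maximum is taken over `[-R, R]`. As `R ≥ 1`, the unit
  -- interval from the maximizer towards the origin stays inside; for a positive maximizer the
  -- estimate is used after reflection.
  set R := |x| + 1
  have hR : 1 ≤ R := by simp [R]
  obtain ⟨x₀, hx₀, hmax⟩ := isCompact_Icc.exists_isMaxOn
    (Set.nonempty_Icc.2 (by linarith : -R ≤ R)) hfc.norm.continuousOn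
  have hmax' : ∀ y, y ∈ Set.Icc (-R) R → ‖f y‖ ≤ ‖f x₀‖ := fun y hy => hmax hy
  have hxR : ‖f x‖ ≤ ‖f x₀‖ := by
    refine hmax' x (abs_le.1 ?_)
    simp [R]
  suffices h : ‖f x₀‖ ≤ ‖f x₀‖ / 2 + (‖z‖ + 4) * (1 + ∫ y, ‖f y‖ ^ 2) by linarith
  rcases le_total x₀ 0 with h0 | h0
  · refine norm_le_of_forall_Icc_le hf hg hf2 hw hw0 hw1 fun y hy => hmax' y ⟨?_, ?_⟩
    · linarith [hx₀.1, hy.1]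
    · linarith [hy.2]
  · have := norm_le_of_forall_Icc_le (f := fun x => f (-x)) (w := fun x => w (-x)) (z := z)
      (x := -x₀) (S := ‖f x₀‖) (hasDerivAt_comp_neg hf) hg.comp_neg hf2.comp_neg hw.comp_neg
      (fun x => hw0 _) (by rwa [integral_neg_eq_self w volume]) fun y hy => hmax' _ ⟨?_, ?_⟩
    · rw [neg_neg, integral_neg_eq_self (fun y => ‖f y‖ ^ 2) volume] at this
      exact this
    · linarith [hy.2]
    · linarith [hx₀.2, hy.1]

end Solution

/-! ### Green's identity on a half-line and the free resolvent -/

/-- The inequality `‖f‖ ≤ 1/n + n ‖f‖²` plays the role of Cauchy-Schwarz: over a length `n²` it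
gives `∫ ‖f‖ ≤ n (1 + ∫ ‖f‖²)`. -/
theorem norm_integral_mul_le_of_sq {f q : ℝ → ℂ} {x C : ℝ} {n : ℕ} (hn : 0 < n)
    (hfc : Continuous f) (hf2 : Integrable fun x => ‖f x‖ ^ 2)
    (hq : ∀ y ∈ Set.Ioc x (x + n ^ 2), ‖q y‖ ≤ C / n ^ 2) :
    ‖∫ y in x..(x + n ^ 2), q y * f y‖ ≤ C * (1 + ∫ y, ‖f y‖ ^ 2) / n := by
  have hn' : (0 : ℝ) < n := by exact_mod_cast hn
  have hxx : x ≤ x + (n : ℝ) ^ 2 := by nlinarith [sq_nonneg (n : ℝ)]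
  have hC : 0 ≤ C := by
    have := (norm_nonneg _).trans (hq (x + (n : ℝ) ^ 2) ⟨by nlinarith, le_rfl⟩)
    by_contra h
    have := div_neg_of_neg_of_pos (not_le.1 h) (by positivity : (0 : ℝ) < (n : ℝ) ^ 2)
    linarith
  have i1 : IntervalIntegrable (fun _ : ℝ => C / (n : ℝ) ^ 3) volume x (x + (n : ℝ) ^ 2) :=
    intervalIntegrable_const
  have i2 : IntervalIntegrable (fun y => C / n * ‖f y‖ ^ 2) volume x (x + (n : ℝ) ^ 2) :=
    Continuous.intervalIntegrable (by fun_prop) _ _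
  calc ‖∫ y in x..(x + n ^ 2), q y * f y‖
      ≤ ∫ y in x..(x + n ^ 2), (C / (n : ℝ) ^ 3 + C / n * ‖f y‖ ^ 2) := by
        refine intervalIntegral.norm_integral_le_of_norm_le hxx
          (Eventually.of_forall fun y hy => ?_) (i1.add i2)
        rw [norm_mul]
        refine (mul_le_mul_of_nonneg_right (hq y hy) (norm_nonneg _)).trans ?_
        have e : ‖f y‖ ≤ 1 / n + n * ‖f y‖ ^ 2 := by
          rw [div_add' _ _ _ hn'.ne', le_div_iff₀ hn']
          nlinarith [sq_nonneg ((n : ℝ) * ‖f y‖ - 1), norm_nonneg (f y),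
            mul_nonneg hn'.le (norm_nonneg (f y))]
        calc C / (n : ℝ) ^ 2 * ‖f y‖ ≤ C / (n : ℝ) ^ 2 * (1 / n + n * ‖f y‖ ^ 2) := by gcongr
          _ = _ := by field_simp
    _ = C / n + C / n * ∫ y in x..(x + n ^ 2), ‖f y‖ ^ 2 := by
        rw [intervalIntegral.integral_add i1 i2, intervalIntegral.integral_const_mul,
          intervalIntegral.integral_const]
        simp only [add_sub_cancel_left, smul_eq_mul]
        field_simp
    _ ≤ C / n + C / n * ∫ y, ‖f y‖ ^ 2 := by
        have j2 : ∫ y in x..(x + n ^ 2), ‖f y‖ ^ 2 ≤ ∫ y, ‖f y‖ ^ 2 := by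
          rw [intervalIntegral.integral_of_le hxx]
          exact setIntegral_le_integral hf2 (Eventually.of_forall fun y => sq_nonneg _)
        gcongr
    _ = C * (1 + ∫ y, ‖f y‖ ^ 2) / n := by ring

/-- Green's identity on a half-line, for a square integrable function `f` and a solution `s` of
`s'' = z s` with bounded derivative. -/
theorem integral_Ioi_mul_eq {f g h s s' : ℝ → ℂ} {z : ℂ} {x C : ℝ}
    (hf : ∀ x, HasDerivAt f (g x) x) (hg : IsPrimitive g h) (hf2 : Integrable fun x => ‖f x‖ ^ 2)
    (hs : ∀ y, HasDerivAt s (s' y) y) (hs' : ∀ y, HasDerivAt s' (z * s y) y)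
    (hsC : ∀ y, x < y → ‖s y‖ ≤ C * (1 + (y - x))) (hsC' : ∀ y, x < y → ‖s' y‖ ≤ C)
    (hi : IntegrableOn (fun y => s y * (z * f y - h y)) (Set.Ioi x)) :
    ∫ y in Set.Ioi x, s y * (z * f y - h y) = s x * g x - s' x * f x := by
  have hfc : Continuous f := continuous_iff_continuousAt.2 fun x => (hf x).continuousAt
  have hsc : Continuous s := continuous_iff_continuousAt.2 fun x => (hs x).continuousAt
  have hsc' : Continuous s' := continuous_iff_continuousAt.2 fun x => (hs' x).continuousAt
  have hC : 0 ≤ C := (norm_nonneg _).trans (hsC' (x + 1) (by linarith))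
  -- The cutoff vanishes to second order at `x + n²`, so no boundary terms arise there and no decay
  -- of `f` or `g` is needed. The error `q` collects the terms of `(s χ)''` in which `χ` is
  -- differentiated.
  set χ : ℕ → ℝ → ℝ := fun n y => (1 - (y - x) / n ^ 2) ^ 2
  set χ' : ℕ → ℝ → ℝ := fun n y => -2 / n ^ 2 * (1 - (y - x) / n ^ 2)
  set q : ℕ → ℝ → ℂ := fun n y => 2 * s' y * χ' n y + s y * ((2 / n ^ 4 : ℝ) : ℂ)
  have hχ : ∀ n y, HasDerivAt (fun y => (χ n y : ℂ)) (χ' n y : ℂ) y := fun n y => by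
    refine HasDerivAt.ofReal_comp ((((((hasDerivAt_id y).sub_const x).div_const
      ((n : ℝ) ^ 2)).const_sub 1).pow 2).congr_deriv ?_)
    simp only [χ', id]; push_cast; ring
  have hχ' : ∀ n y, HasDerivAt (fun y => (χ' n y : ℂ)) ((2 / n ^ 4 : ℝ) : ℂ) y := fun n y => by
    refine HasDerivAt.ofReal_comp ((((((hasDerivAt_id y).sub_const x).div_const
      ((n : ℝ) ^ 2)).const_sub 1).const_mul (-2 / (n : ℝ) ^ 2)).congr_deriv ?_)
    ring
  have hle : ∀ n : ℕ, x ≤ x + (n : ℝ) ^ 2 := fun n => by nlinarith [sq_nonneg (n : ℝ)]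
  have hχc : ∀ n, Continuous fun y => (χ n y : ℂ) := fun n => by simp only [χ]; fun_prop
  have hqc : ∀ n, Continuous (q n) := fun n => by simp only [q, χ']; fun_prop
  have hbd : ∀ n : ℕ, 0 < n → ∀ y ∈ Set.Ioc x (x + (n : ℝ) ^ 2), 0 ≤ (y - x) / n ^ 2 ∧
      (y - x) / n ^ 2 ≤ 1 := fun n hn y hy => by
    have hn' : (0 : ℝ) < n := by exact_mod_cast hn
    refine ⟨div_nonneg (by linarith [hy.1]) (by positivity), (div_le_one (by positivity)).2 ?_⟩
    linarith [hy.2]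
  have hI : ∀ n : ℕ, IntervalIntegrable (fun y => s y * (z * f y - h y)) volume x
      (x + (n : ℝ) ^ 2) := fun n =>
    (((continuous_const.mul hfc).intervalIntegrable _ _).sub
      (hg.intervalIntegrable _ _)).continuousOn_mul hsc.continuousOn
  have key : ∀ n : ℕ, 0 < n → ∫ y in x..(x + (n : ℝ) ^ 2), (χ n y : ℂ) * (s y * (z * f y - h y)) =
      s x * g x - s' x * f x + 2 / (n : ℂ) ^ 2 * (s x * f x) -
        ∫ y in x..(x + (n : ℝ) ^ 2), q n y * f y := fun n hn => by
    have hn' : (n : ℂ) ≠ 0 := by exact_mod_cast hn.ne'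
    have hn'' : (n : ℝ) ≠ 0 := by exact_mod_cast hn.ne'
    have h1 := hg.green (hle n) (m := fun y => s y * χ n y)
      (m' := fun y => s' y * χ n y + s y * χ' n y)
      (m'' := fun y => z * s y * χ n y + q n y)
      (fun y => (hs y).mul (hχ n y))
      (fun y => (((hs' y).mul (hχ n y)).add ((hs y).mul (hχ' n y))).congr_deriv
        (by simp only [q]; ring)) (by have := hχc n; have := hqc n; fun_prop) hf
    rw [eq_sub_iff_add_eq, ← intervalIntegral.integral_add
      ((hI n).continuousOn_mul (hχc n).continuousOn)
      (show IntervalIntegrable (fun y => q n y * f y) _ _ _ from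
        ((hqc n).mul hfc).intervalIntegrable _ _)]
    have e : ∀ y, (χ n y : ℂ) * (s y * (z * f y - h y)) + q n y * f y =
        -(s y * χ n y * h y - (z * s y * χ n y + q n y) * f y) := fun y => by ring
    simp only [e]
    rw [intervalIntegral.integral_neg, h1]
    simp only [χ, χ', add_sub_cancel_left, div_self (pow_ne_zero 2 hn''), sub_self, zero_div]
    push_cast
    ring
  have lim1 : Tendsto (fun n : ℕ => ∫ y in x..(x + (n : ℝ) ^ 2),
      (χ n y : ℂ) * (s y * (z * f y - h y))) atTop
      (𝓝 (∫ y in Set.Ioi x, s y * (z * f y - h y))) := by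
    have e : ∀ n : ℕ, ∫ y in x..(x + (n : ℝ) ^ 2), (χ n y : ℂ) * (s y * (z * f y - h y)) =
        ∫ y in Set.Ioi x, (Set.Iic (x + (n : ℝ) ^ 2)).indicator
          (fun y => (χ n y : ℂ) * (s y * (z * f y - h y))) y := fun n => by
      rw [intervalIntegral.integral_of_le (hle n), setIntegral_indicator measurableSet_Iic,
        Set.Ioi_inter_Iic]
    simp only [e]
    refine tendsto_integral_of_dominated_convergence _ (fun n => ?_) hi.norm (fun n => ?_) ?_
    · exact ((hχc n).aestronglyMeasurable.mul hi.1).indicator measurableSet_Iic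
    · filter_upwards [ae_restrict_mem measurableSet_Ioi] with y hy
      by_cases hy' : y ∈ Set.Iic (x + (n : ℝ) ^ 2)
      · rw [Set.indicator_of_mem hy', norm_mul]
        refine mul_le_of_le_one_left (norm_nonneg _) ?_
        -- For `n = 0` division by zero makes the cutoff identically `1`.
        rcases Nat.eq_zero_or_pos n with rfl | hn
        · simp [χ]
        · obtain ⟨h1, h2⟩ := hbd n hn y ⟨hy, hy'⟩
          rw [Complex.norm_real, Real.norm_of_nonneg (sq_nonneg _)]
          nlinarith
      · rw [Set.indicator_of_notMem hy', norm_zero]; exact norm_nonneg _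
    · filter_upwards with y
      have hsq : Tendsto (fun n : ℕ => (n : ℝ) ^ 2) atTop atTop :=
        (tendsto_pow_atTop two_ne_zero).comp tendsto_natCast_atTop_atTop
      have hχ1 : Tendsto (fun n => (χ n y : ℂ)) atTop (𝓝 1) := by
        have h1 : Tendsto (fun n : ℕ => (y - x) / (n : ℝ) ^ 2) atTop (𝓝 0) :=
          tendsto_const_nhds.div_atTop hsq
        have h2 : Tendsto (fun n => χ n y) atTop (𝓝 ((1 - 0) ^ 2)) := (h1.const_sub 1).pow 2
        rw [sub_zero, one_pow] at h2
        exact_mod_cast (Complex.continuous_ofReal.tendsto 1).comp h2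
      have := hχ1.mul_const (s y * (z * f y - h y))
      rw [one_mul] at this
      refine this.congr' ?_
      filter_upwards [hsq.eventually_ge_atTop (y - x)] with n hn
      rw [Set.indicator_of_mem]
      rw [Set.mem_Iic]; linarith
  have lim2 : Tendsto (fun n : ℕ => ∫ y in x..(x + (n : ℝ) ^ 2), q n y * f y) atTop (𝓝 0) := by
    have hz : Tendsto (fun n : ℕ => 8 * C * (1 + ∫ y, ‖f y‖ ^ 2) / (n : ℝ)) atTop (𝓝 0) :=
      tendsto_const_nhds.div_atTop tendsto_natCast_atTop_atTop
    refine squeeze_zero_norm' ?_ hz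
    filter_upwards [eventually_gt_atTop 0] with n hn
    refine norm_integral_mul_le_of_sq hn hfc hf2 fun y hy => ?_
    have hn' : (1 : ℝ) ≤ n := by exact_mod_cast hn
    have hn2 : (1 : ℝ) ≤ (n : ℝ) ^ 2 := one_le_pow₀ hn'
    obtain ⟨h1, h2⟩ := hbd n hn y hy
    have b1 : ‖2 * s' y * χ' n y‖ ≤ 4 * C / (n : ℝ) ^ 2 := by
      have : ‖(χ' n y : ℂ)‖ ≤ 2 / (n : ℝ) ^ 2 := by
        rw [Complex.norm_real, Real.norm_eq_abs, abs_mul, abs_div, abs_neg, abs_two,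
          abs_of_nonneg (by positivity : (0 : ℝ) ≤ (n : ℝ) ^ 2)]
        refine mul_le_of_le_one_right (by positivity) (abs_le.2 ⟨by linarith, by linarith⟩)
      rw [norm_mul, norm_mul]
      calc ‖(2 : ℂ)‖ * ‖s' y‖ * ‖(χ' n y : ℂ)‖ ≤ 2 * C * (2 / (n : ℝ) ^ 2) := by
            gcongr
            · simp
            · exact hsC' y hy.1
        _ = 4 * C / (n : ℝ) ^ 2 := by ring
    -- The linear growth of `s` over a length `n²` is beaten by `χ'' = 2/n⁴`.
    have b2 : ‖s y * ((2 / n ^ 4 : ℝ) : ℂ)‖ ≤ 4 * C / (n : ℝ) ^ 2 := by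
      rw [norm_mul, Complex.norm_real, Real.norm_of_nonneg (by positivity)]
      have : ‖s y‖ ≤ C * (2 * (n : ℝ) ^ 2) := by
        refine (hsC y hy.1).trans (mul_le_mul_of_nonneg_left ?_ hC)
        linarith [hy.2]
      calc ‖s y‖ * (2 / (n : ℝ) ^ 4) ≤ C * (2 * (n : ℝ) ^ 2) * (2 / (n : ℝ) ^ 4) := by gcongr
        _ = 4 * C / (n : ℝ) ^ 2 := by field_simp; ring
    calc ‖q n y‖ ≤ 4 * C / (n : ℝ) ^ 2 + 4 * C / (n : ℝ) ^ 2 :=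
          (norm_add_le _ _).trans (add_le_add b1 b2)
      _ = 8 * C / (n : ℝ) ^ 2 := by ring
  have lim3 : Tendsto (fun n : ℕ => s x * g x - s' x * f x + 2 / (n : ℂ) ^ 2 * (s x * f x) -
        ∫ y in x..(x + (n : ℝ) ^ 2), q n y * f y) atTop
      (𝓝 (s x * g x - s' x * f x + 0 * (s x * f x) - 0)) := by
    refine (tendsto_const_nhds.add (Tendsto.mul_const _ ?_)).sub lim2
    have : Tendsto (fun n : ℕ => 2 / (n : ℝ) ^ 2) atTop (𝓝 0) :=
      tendsto_const_nhds.div_atTop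
        ((tendsto_pow_atTop two_ne_zero).comp tendsto_natCast_atTop_atTop)
    have := (Complex.continuous_ofReal.tendsto 0).comp this
    refine (this.congr fun n => ?_)
    simp
  rw [zero_mul, add_zero, sub_zero] at lim3
  refine tendsto_nhds_unique lim1 (lim3.congr' ?_)
  filter_upwards [eventually_gt_atTop 0] with n hn
  exact (key n hn).symm

theorem hasDerivAt_cexp_neg_mul (κ : ℂ) (x y : ℝ) :
    HasDerivAt (fun y : ℝ => Complex.exp (-κ * ((y - x : ℝ) : ℂ)))
      (-κ * Complex.exp (-κ * ((y - x : ℝ) : ℂ))) y := by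
  have h : HasDerivAt (fun y : ℝ => ((y - x : ℝ) : ℂ)) ((1 : ℝ) : ℂ) y :=
    HasDerivAt.ofReal_comp ((hasDerivAt_id y).sub_const x)
  exact ((h.const_mul (-κ)).cexp).congr_deriv (by push_cast; ring)

theorem norm_cexp_neg_mul_le {κ : ℂ} (hκ : 0 ≤ κ.re) {t : ℝ} (ht : 0 ≤ t) :
    ‖Complex.exp (-κ * (t : ℂ))‖ ≤ 1 := by
  rw [Complex.norm_exp, Real.exp_le_one_iff]
  simp only [neg_mul, Complex.neg_re, Complex.mul_re, Complex.ofReal_re, Complex.ofReal_im]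
  nlinarith [mul_nonneg hκ ht]

section

variable {f g h : ℝ → ℂ} {κ : ℂ}

/-- The half-line identity for the decaying exponential, which has value `1` and derivative `-κ` at
`x`. -/
theorem integral_Ioi_exp_mul (hκ : 0 < κ.re) (hf : ∀ x, HasDerivAt f (g x) x)
    (hg : IsPrimitive g h) (hf2 : Integrable fun x => ‖f x‖ ^ 2)
    (hk : Integrable fun y => κ ^ 2 * f y - h y) (x : ℝ) :
    ∫ y in Set.Ioi x, Complex.exp (-κ * ((y - x : ℝ) : ℂ)) * (κ ^ 2 * f y - h y) =
      g x + κ * f x := by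
  have hb : ∀ y, x < y → ‖Complex.exp (-κ * ((y - x : ℝ) : ℂ))‖ ≤ 1 := fun y hy =>
    norm_cexp_neg_mul_le hκ.le (sub_nonneg.2 hy.le)
  rw [integral_Ioi_mul_eq (C := 1 + ‖κ‖) hf hg hf2 (hasDerivAt_cexp_neg_mul κ x)
    (fun y => ((hasDerivAt_cexp_neg_mul κ x y).const_mul (-κ)).congr_deriv (by ring))]
  · simp
  · intro y hy
    have h0 := norm_nonneg κ
    have h1 : 0 < y - x := sub_pos.2 hy
    refine (hb y hy).trans ?_
    nlinarith [mul_nonneg h0 h1.le]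
  · intro y hy
    rw [norm_mul, norm_neg]
    nlinarith [hb y hy, norm_nonneg κ]
  · refine (hk.integrableOn).bdd_mul (c := 1)
      (Continuous.aestronglyMeasurable (by fun_prop)) ?_
    filter_upwards [ae_restrict_mem measurableSet_Ioi] with y hy
    exact hb y hy

theorem integrable_exp_abs_mul {k : ℝ → ℂ} (hκ : 0 ≤ κ.re) (hk : Integrable k) (x : ℝ) :
    Integrable fun y => Complex.exp (-κ * ((|x - y| : ℝ) : ℂ)) * k y :=
  hk.bdd_mul (c := 1) (Continuous.aestronglyMeasurable (by fun_prop))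
    (Eventually.of_forall fun _ => norm_cexp_neg_mul_le hκ (abs_nonneg _))

/-- A square integrable function is recovered from `κ² f - f''` through the free resolvent. -/
theorem integral_exp_abs_mul (hκ : 0 < κ.re) (hf : ∀ x, HasDerivAt f (g x) x)
    (hg : IsPrimitive g h) (hf2 : Integrable fun x => ‖f x‖ ^ 2)
    (hk : Integrable fun y => κ ^ 2 * f y - h y) (x : ℝ) :
    ∫ y, Complex.exp (-κ * ((|x - y| : ℝ) : ℂ)) * (κ ^ 2 * f y - h y) = 2 * κ * f x := by
  have h1 := integral_Ioi_exp_mul hκ hf hg hf2 hk x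
  -- The left half-line, by reflection, contributes `-g x + κ f x`, so `g` cancels from the sum.
  have h2 := integral_Ioi_exp_mul hκ (hasDerivAt_comp_neg hf) hg.comp_neg
    hf2.comp_neg hk.comp_neg (-x)
  have e2 := integral_comp_neg_Ioi (-x)
    (fun y => Complex.exp (-κ * ((x - y : ℝ) : ℂ)) * (κ ^ 2 * f y - h y))
  simp only [sub_neg_eq_add, neg_neg] at h2 e2
  have e3 : ∀ y : ℝ, x + y = y + x := fun y => add_comm _ _
  simp only [e3] at e2
  rw [e2] at h2
  have hi := integrable_exp_abs_mul hκ.le hk x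
  rw [← intervalIntegral.integral_Iic_add_Ioi hi.integrableOn hi.integrableOn (b := x)]
  rw [setIntegral_congr_fun (g := fun y => Complex.exp (-κ * ((x - y : ℝ) : ℂ)) *
      (κ ^ 2 * f y - h y)) measurableSet_Iic fun y hy => by
        simp only [abs_of_nonneg (sub_nonneg.2 (Set.mem_Iic.1 hy))], h2,
    setIntegral_congr_fun (g := fun y => Complex.exp (-κ * ((y - x : ℝ) : ℂ)) *
      (κ ^ 2 * f y - h y)) measurableSet_Ioi fun y hy => by
        simp only [abs_sub_comm x y, abs_of_pos (sub_pos.2 (Set.mem_Ioi.1 hy))], h1]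
  ring

/-! ### Excluding imaginary `κ` -/

/-- The solution `sinh (κ (y - x)) / κ`, or `y - x` when `κ = 0`. For imaginary `κ` its derivative
is a cosine, so its growth is at most linear. -/
theorem exists_sinh_solution (hκ : κ.re = 0) (x : ℝ) :
    ∃ s s' : ℝ → ℂ, (∀ y, HasDerivAt s (s' y) y) ∧ (∀ y, HasDerivAt s' (κ ^ 2 * s y) y) ∧
      s x = 0 ∧ s' x = 1 ∧ (∀ y, ‖s' y‖ ≤ 1) ∧ ∀ y, x < y → ‖s y‖ ≤ y - x := by
  have hd : ∀ y : ℝ, HasDerivAt (fun y : ℝ => κ * ((y - x : ℝ) : ℂ)) κ y := fun y => by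
    have h : HasDerivAt (fun y : ℝ => ((y - x : ℝ) : ℂ)) ((1 : ℝ) : ℂ) y :=
      HasDerivAt.ofReal_comp ((hasDerivAt_id y).sub_const x)
    exact (h.const_mul κ).congr_deriv (by simp)
  have hcosh : ∀ y : ℝ, ‖Complex.cosh (κ * ((y - x : ℝ) : ℂ))‖ ≤ 1 := fun y => by
    have e : κ * ((y - x : ℝ) : ℂ) = ((κ.im * (y - x) : ℝ) : ℂ) * Complex.I := by
      apply Complex.ext <;> simp [hκ]
    rw [e, Complex.cosh_mul_I, ← Complex.ofReal_cos, Complex.norm_real]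
    exact Real.abs_cos_le_one _
  obtain ⟨s, hs, hs', hsx⟩ : ∃ s : ℝ → ℂ,
      (∀ y, HasDerivAt s (Complex.cosh (κ * ((y - x : ℝ) : ℂ))) y) ∧
      (∀ y, κ ^ 2 * s y = κ * Complex.sinh (κ * ((y - x : ℝ) : ℂ))) ∧ s x = 0 := by
    by_cases h0 : κ = 0
    · refine ⟨fun y => ((y - x : ℝ) : ℂ), fun y => ?_, fun y => by simp [h0], by simp⟩
      have h : HasDerivAt (fun y : ℝ => ((y - x : ℝ) : ℂ)) ((1 : ℝ) : ℂ) y :=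
        HasDerivAt.ofReal_comp ((hasDerivAt_id y).sub_const x)
      simpa [h0] using h
    · refine ⟨fun y => Complex.sinh (κ * ((y - x : ℝ) : ℂ)) / κ, fun y => ?_, fun y => ?_,
        by simp⟩
      · exact (((Complex.hasDerivAt_sinh _).comp y (hd y)).div_const κ).congr_deriv (by field_simp)
      · field_simp
  refine ⟨s, _, hs, fun y => ((Complex.hasDerivAt_cosh _).comp y (hd y)).congr_deriv
    (by rw [hs']; ring), hsx, by simp, hcosh,
    fun y hy => ?_⟩
  have := Convex.norm_image_sub_le_of_norm_hasDerivWithin_le (s := Set.univ) (x := x) (y := y)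
    (fun y _ => (hs y).hasDerivWithinAt) (fun y _ => hcosh y) convex_univ trivial trivial
  rwa [hsx, sub_zero, one_mul, Real.norm_of_nonneg (sub_nonneg.2 hy.le)] at this

/-- A solution `s` with `s x = 0` and `s' x = 1` turns the half-line identity into the Volterra
equation `f x = -∫ s w f` over `y > x`. For `x ≥ 0` one has `‖s y‖ ≤ y - x ≤ |y|`, so the first
moment suffices. -/
theorem norm_le_of_re_eq_zero {w : ℝ → ℝ} {S : ℝ} (hκ : κ.re = 0)
    (hf : ∀ x, HasDerivAt f (g x) x) (hg : IsPrimitive g fun y => (κ ^ 2 - w y) * f y)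
    (hf2 : Integrable fun x => ‖f x‖ ^ 2) (hfS : ∀ x, ‖f x‖ ≤ S) (hw : Integrable w)
    (hw0 : ∀ x, 0 ≤ w x) (hxw : Integrable fun x => |x| * w x) {x : ℝ} (hx : 0 ≤ x) :
    ‖f x‖ ≤ (∫ y, |y| * w y) * S := by
  have hfc : Continuous f := continuous_iff_continuousAt.2 fun x => (hf x).continuousAt
  have hS0 : 0 ≤ S := (norm_nonneg _).trans (hfS 0)
  obtain ⟨s, s', hs, hs', hsx, hsx', hs1, hst⟩ := exists_sinh_solution hκ x
  have hsc : Continuous s := continuous_iff_continuousAt.2 fun x => (hs x).continuousAt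
  have e : ∀ y, s y * (κ ^ 2 * f y - (κ ^ 2 - w y) * f y) = w y * (s y * f y) := fun y => by ring
  have hb : ∀ y ∈ Set.Ioi x, ‖w y * (s y * f y)‖ ≤ |y| * w y * S := fun y hy => by
    rw [norm_mul, norm_mul, Complex.norm_real, Real.norm_of_nonneg (hw0 y), mul_comm |y|,
      mul_assoc]
    refine mul_le_mul_of_nonneg_left ?_ (hw0 y)
    refine mul_le_mul ((hst y hy).trans ?_) (hfS y) (norm_nonneg _) (abs_nonneg _)
    exact (by linarith : y - x ≤ y).trans (le_abs_self y)
  have hi : IntegrableOn (fun y => (w y : ℂ) * (s y * f y)) (Set.Ioi x) := by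
    refine (hxw.mul_const S).integrableOn.mono' ?_ ?_
    · exact (hw.ofReal.1.mul (hsc.mul hfc).aestronglyMeasurable).restrict
    · filter_upwards [ae_restrict_mem measurableSet_Ioi] with y hy using hb y hy
  have key := integral_Ioi_mul_eq (C := 1) hf hg hf2 hs hs'
    (fun y hy => (hst y hy).trans (by linarith)) (fun y _ => hs1 y) (by simpa only [e] using hi)
  simp only [e] at key
  have e2 : f x = -∫ y in Set.Ioi x, (w y : ℂ) * (s y * f y) := by
    rw [key, hsx, hsx']; ring
  rw [e2, norm_neg, ← integral_mul_const]
  calc ‖∫ y in Set.Ioi x, (w y : ℂ) * (s y * f y)‖ ≤ ∫ y in Set.Ioi x, |y| * w y * S := by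
        refine norm_integral_le_of_norm_le (hxw.mul_const S).integrableOn ?_
        filter_upwards [ae_restrict_mem measurableSet_Ioi] with y hy using hb y hy
    _ ≤ ∫ y, |y| * w y * S := by
        refine setIntegral_le_integral (hxw.mul_const S) (Eventually.of_forall fun y => ?_)
        exact mul_nonneg (mul_nonneg (abs_nonneg _) (hw0 y)) hS0

/-- There are no square integrable solutions of `f'' = (κ² - w) f` for imaginary `κ`, if the first
moment of `w` is small. -/
theorem eq_zero_of_re_eq_zero {w : ℝ → ℝ} {S : ℝ} (hκ : κ.re = 0)
    (hf : ∀ x, HasDerivAt f (g x) x) (hg : IsPrimitive g fun y => (κ ^ 2 - w y) * f y)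
    (hf2 : Integrable fun x => ‖f x‖ ^ 2) (hfS : ∀ x, ‖f x‖ ≤ S) (hw : Integrable w)
    (hw0 : ∀ x, 0 ≤ w x) (hxw : Integrable fun x => |x| * w x) (hxw1 : ∫ x, |x| * w x < 1)
    (x : ℝ) : f x = 0 := by
  have hbdd : BddAbove (Set.range fun x => ‖f x‖) := ⟨S, by rintro _ ⟨y, rfl⟩; exact hfS y⟩
  have hle : ∀ y, ‖f y‖ ≤ ⨆ x, ‖f x‖ := fun y => le_ciSup hbdd y
  have hstep : ∀ y, ‖f y‖ ≤ (∫ y, |y| * w y) * ⨆ x, ‖f x‖ := fun y => by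
    rcases le_total 0 y with hy | hy
    · exact norm_le_of_re_eq_zero hκ hf hg hf2 hle hw hw0 hxw hy
    · have := norm_le_of_re_eq_zero (f := fun x => f (-x)) (w := fun x => w (-x)) hκ
        (hasDerivAt_comp_neg hf) hg.comp_neg hf2.comp_neg (fun x => hle (-x)) hw.comp_neg
        (fun x => hw0 _) (by simpa using hxw.comp_neg) (neg_nonneg.2 hy)
      have e := integral_neg_eq_self (fun y => |y| * w y) volume
      simp only [abs_neg] at e
      rwa [neg_neg, e] at this
  have h1 : ⨆ x, ‖f x‖ ≤ (∫ y, |y| * w y) * ⨆ x, ‖f x‖ := ciSup_le hstep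
  have h0 : 0 ≤ ⨆ x, ‖f x‖ := (norm_nonneg _).trans (hle 0)
  have h2 : ⨆ x, ‖f x‖ ≤ 0 := by nlinarith
  exact norm_le_zero_iff.1 ((hle x).trans h2)

end

/-! ### The regularized kernel and its operator -/

/-- On the convex half-plane `Re z ≥ 0` the derivative of `exp (-z)` has norm at most `1`. -/
theorem norm_exp_neg_sub_exp_neg_le {a b : ℂ} (ha : 0 ≤ a.re) (hb : 0 ≤ b.re) :
    ‖Complex.exp (-a) - Complex.exp (-b)‖ ≤ ‖a - b‖ := by
  have hd : ∀ z ∈ {z : ℂ | 0 ≤ z.re}, HasDerivWithinAt (fun z => Complex.exp (-z))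
      (Complex.exp (-z) * -1) {z : ℂ | 0 ≤ z.re} z := fun z _ =>
    ((hasDerivAt_neg z).cexp).hasDerivWithinAt
  have := Convex.norm_image_sub_le_of_norm_hasDerivWithin_le (C := 1) hd (fun z hz => by
    rw [norm_mul, norm_neg, norm_one, mul_one, Complex.norm_exp, Real.exp_le_one_iff,
      Complex.neg_re, neg_nonpos]
    exact hz) (convex_halfSpace_re_ge 0) hb ha
  simpa using this

/-- The kernel of the free resolvent at `-κ²` with its singular part `1 / (2 κ)` removed. -/
noncomputable def regularKernel (κ : ℂ) (x y : ℝ) : ℂ :=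
  (Complex.exp (-κ * ((|x - y| : ℝ) : ℂ)) - 1) / (2 * κ)

theorem norm_exp_sub_one_le {κ : ℂ} (hκ : 0 ≤ κ.re) {t : ℝ} (ht : 0 ≤ t) :
    ‖Complex.exp (-κ * (t : ℂ)) - 1‖ ≤ ‖κ‖ * t := by
  have := norm_exp_neg_sub_exp_neg_le (a := κ * t) (b := 0)
    (by simpa using mul_nonneg hκ ht) le_rfl
  simpa [abs_of_nonneg ht] using this

theorem abs_sub_le_mul (x y : ℝ) : |x - y| ≤ (1 + |x|) * (1 + |y|) := by
  have := abs_sub x y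
  nlinarith [abs_nonneg x, abs_nonneg y, mul_nonneg (abs_nonneg x) (abs_nonneg y)]

/-- The numerator is at most `‖κ‖ |x - y|`, which cancels the denominator and makes the bound
uniform as `κ → 0`. At `κ = 0` division by zero gives the value `0`. -/
theorem norm_regularKernel_le {κ : ℂ} (hκ : 0 ≤ κ.re) (x y : ℝ) :
    ‖regularKernel κ x y‖ ≤ (1 + |x|) * (1 + |y|) / 2 := by
  rw [regularKernel, norm_div, norm_mul, Complex.norm_two]
  refine le_trans ?_ (div_le_div_of_nonneg_right (abs_sub_le_mul x y) zero_le_two)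
  by_cases h0 : κ = 0
  · simp only [h0, norm_zero, mul_zero, div_zero]; positivity
  · have h1 : 0 < ‖κ‖ := norm_pos_iff.2 h0
    rw [div_le_div_iff₀ (by positivity) two_pos]
    nlinarith [norm_exp_sub_one_le hκ (abs_nonneg (x - y))]

/-- The constant `1/c` degenerates for small `c`, but only one power of `|x - y|` is spent; a bound
uniform in `κ` would cost `|x - y|²` and a higher moment of the weight. -/
theorem norm_regularKernel_sub_le {κ κ' : ℂ} {c : ℝ} (hc : 0 < c) (hκ : c ≤ κ.re)
    (hκ' : c ≤ κ'.re) (x y : ℝ) :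
    ‖regularKernel κ x y - regularKernel κ' x y‖ ≤
      (1 + |x|) * (1 + |y|) / c * ‖κ - κ'‖ := by
  have hn : c ≤ ‖κ‖ := hκ.trans (Complex.re_le_norm κ)
  have hn' : c ≤ ‖κ'‖ := hκ'.trans (Complex.re_le_norm κ')
  have h0 : κ ≠ 0 := norm_pos_iff.1 (hc.trans_le hn)
  have h0' : κ' ≠ 0 := norm_pos_iff.1 (hc.trans_le hn')
  set r := |x - y|
  have hr : 0 ≤ r := abs_nonneg _
  -- Change the numerator first, then the denominator.
  have e : regularKernel κ x y - regularKernel κ' x y =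
      (Complex.exp (-κ * (r : ℂ)) - Complex.exp (-κ' * (r : ℂ))) / (2 * κ) +
        (Complex.exp (-κ' * (r : ℂ)) - 1) / κ' * ((κ' - κ) / (2 * κ)) := by
    change (Complex.exp (-κ * (r : ℂ)) - 1) / (2 * κ) -
      (Complex.exp (-κ' * (r : ℂ)) - 1) / (2 * κ') = _
    generalize Complex.exp (-κ * (r : ℂ)) = a
    generalize Complex.exp (-κ' * (r : ℂ)) = b
    field_simp; ring
  have b1 : ‖Complex.exp (-κ * (r : ℂ)) - Complex.exp (-κ' * (r : ℂ))‖ ≤ r * ‖κ - κ'‖ := by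
    have := norm_exp_neg_sub_exp_neg_le (a := κ * r) (b := κ' * r)
      (by simpa using mul_nonneg (hc.le.trans hκ) hr)
      (by simpa using mul_nonneg (hc.le.trans hκ') hr)
    rw [← sub_mul, norm_mul, Complex.norm_real, Real.norm_of_nonneg hr, mul_comm ‖κ - κ'‖,
      ← neg_mul, ← neg_mul] at this
    exact this
  have b2 : ‖(Complex.exp (-κ' * (r : ℂ)) - 1) / κ'‖ ≤ r := by
    rw [norm_div, div_le_iff₀ (hc.trans_le hn'), mul_comm r]
    exact norm_exp_sub_one_le (hc.le.trans hκ') hr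
  have h2c : 2 * c ≤ ‖2 * κ‖ := by rw [norm_mul, Complex.norm_two]; linarith
  have b3 : ‖(κ' - κ) / (2 * κ)‖ ≤ ‖κ - κ'‖ / (2 * c) := by
    rw [norm_div, norm_sub_rev]
    gcongr
  rw [e]
  calc _ ≤ r * ‖κ - κ'‖ / (2 * c) + r * (‖κ - κ'‖ / (2 * c)) := by
        refine (norm_add_le _ _).trans (add_le_add ?_ ?_)
        · rw [norm_div]; gcongr
        · rw [norm_mul]; gcongr
    _ = r / c * ‖κ - κ'‖ := by field_simp; ring
    _ ≤ _ := by
        have := abs_sub_le_mul x y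
        gcongr

theorem continuous_regularKernel_left (κ : ℂ) (y : ℝ) : Continuous fun x => regularKernel κ x y := by
  simp only [regularKernel, div_eq_mul_inv]; fun_prop

theorem continuous_regularKernel_right (κ : ℂ) (x : ℝ) : Continuous (regularKernel κ x) := by
  unfold regularKernel; simp only [div_eq_mul_inv]; fun_prop

/-- Nonnegative integrable functions with two moments. -/
structure IsWeight (W : ℝ → ℝ) : Prop where
  nonneg : ∀ x, 0 ≤ W x
  integrable : Integrable W
  integrable_moment : Integrable fun x => (1 + |x|) ^ 2 * W x

/-- The second moment of a weight. -/
noncomputable def moment (W : ℝ → ℝ) : ℝ := ∫ x, (1 + |x|) ^ 2 * W x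

/-- Functions of at most linear growth. -/
structure LinearGrowth (S : ℝ) (u : ℝ → ℂ) : Prop where
  continuous : Continuous u
  norm_le : ∀ x, ‖u x‖ ≤ S * (1 + |x|)

theorem one_le_one_add_abs (x : ℝ) : 1 ≤ 1 + |x| := le_add_of_nonneg_right (abs_nonneg x)

theorem LinearGrowth.nonneg {S : ℝ} {u : ℝ → ℂ} (hu : LinearGrowth S u) : 0 ≤ S := by
  simpa using (norm_nonneg _).trans (hu.norm_le 0)

/-- The regular part of the free resolvent, composed with multiplication by `W`. -/
noncomputable def regularOp (W : ℝ → ℝ) (κ : ℂ) (u : ℝ → ℂ) (x : ℝ) : ℂ :=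
  ∫ y, regularKernel κ x y * (W y * u y)

section Weight

variable {W : ℝ → ℝ} {S : ℝ} {u : ℝ → ℂ} {κ : ℂ}

theorem IsWeight.integral_le_moment (hW : IsWeight W) : ∫ x, W x ≤ moment W :=
  integral_mono hW.integrable hW.integrable_moment fun x =>
    le_mul_of_one_le_left (hW.nonneg x) (one_le_pow₀ (one_le_one_add_abs x))

theorem IsWeight.norm_mul_le (hW : IsWeight W) (hu : LinearGrowth S u) (y : ℝ) :
    ‖(W y : ℂ) * u y‖ ≤ S * ((1 + |y|) * W y) := by
  rw [norm_mul, Complex.norm_real, Real.norm_of_nonneg (hW.nonneg y)]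
  nlinarith [mul_le_mul_of_nonneg_left (hu.norm_le y) (hW.nonneg y)]

theorem IsWeight.norm_mul_le' (hW : IsWeight W) (hu : LinearGrowth S u) (y : ℝ) :
    ‖(W y : ℂ) * u y‖ ≤ S * ((1 + |y|) ^ 2 * W y) := by
  refine (hW.norm_mul_le hu y).trans (mul_le_mul_of_nonneg_left ?_ hu.nonneg)
  refine mul_le_mul_of_nonneg_right ?_ (hW.nonneg y)
  exact le_self_pow₀ (one_le_one_add_abs y) two_ne_zero

theorem IsWeight.aestronglyMeasurable_mul (hW : IsWeight W) (hu : Continuous u) :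
    AEStronglyMeasurable (fun y => (W y : ℂ) * u y) volume :=
  hW.integrable.ofReal.1.mul hu.aestronglyMeasurable

theorem IsWeight.integrable_mul (hW : IsWeight W) (hu : LinearGrowth S u) :
    Integrable fun y => (W y : ℂ) * u y :=
  (hW.integrable_moment.const_mul S).mono' (hW.aestronglyMeasurable_mul hu.continuous)
    (Eventually.of_forall (hW.norm_mul_le' hu))

theorem IsWeight.norm_integral_mul_le (hW : IsWeight W) (hu : LinearGrowth S u) :
    ‖∫ y, (W y : ℂ) * u y‖ ≤ S * moment W := by
  rw [moment, ← integral_const_mul]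
  exact norm_integral_le_of_norm_le (hW.integrable_moment.const_mul S)
    (Eventually.of_forall (hW.norm_mul_le' hu))

/-- One factor `1 + |y|` comes from the kernel and one from `u`: this is where the second moment
enters. -/
theorem IsWeight.norm_kernel_mul_le (hW : IsWeight W) (hu : LinearGrowth S u) {k : ℂ} {x y B : ℝ}
    (hk : ‖k‖ ≤ (1 + |x|) * (1 + |y|) * B) :
    ‖k * (W y * u y)‖ ≤ (1 + |x|) * (B * S) * ((1 + |y|) ^ 2 * W y) := by
  rw [norm_mul]
  calc ‖k‖ * ‖(W y : ℂ) * u y‖ ≤ ((1 + |x|) * (1 + |y|) * B) * (S * ((1 + |y|) * W y)) :=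
        mul_le_mul hk (hW.norm_mul_le hu y) (norm_nonneg _) ((norm_nonneg _).trans hk)
    _ = _ := by ring

theorem IsWeight.norm_integral_kernel_mul_le (hW : IsWeight W) (hu : LinearGrowth S u)
    {k : ℝ → ℂ} {x B : ℝ} (hk : ∀ y, ‖k y‖ ≤ (1 + |x|) * (1 + |y|) * B) :
    ‖∫ y, k y * (W y * u y)‖ ≤ B * S * moment W * (1 + |x|) := by
  have e : B * S * moment W * (1 + |x|) =
      ∫ y, (1 + |x|) * (B * S) * ((1 + |y|) ^ 2 * W y) := by
    rw [integral_const_mul, moment]; ring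
  rw [e]
  exact norm_integral_le_of_norm_le (hW.integrable_moment.const_mul _)
    (Eventually.of_forall fun y => hW.norm_kernel_mul_le hu (hk y))

theorem IsWeight.integrable_regularKernel_mul (hW : IsWeight W) (hκ : 0 ≤ κ.re)
    (hu : LinearGrowth S u) (x : ℝ) :
    Integrable fun y => regularKernel κ x y * (W y * u y) :=
  (hW.integrable_moment.const_mul ((1 + |x|) * (2⁻¹ * S))).mono'
    ((continuous_regularKernel_right κ x).aestronglyMeasurable.mul
      (hW.aestronglyMeasurable_mul hu.continuous))
    (Eventually.of_forall fun y => hW.norm_kernel_mul_le hu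
      ((norm_regularKernel_le hκ x y).trans_eq (div_eq_mul_inv _ _)))

theorem IsWeight.norm_regularOp_le (hW : IsWeight W) (hκ : 0 ≤ κ.re) (hu : LinearGrowth S u)
    (x : ℝ) : ‖regularOp W κ u x‖ ≤ 2⁻¹ * S * moment W * (1 + |x|) :=
  hW.norm_integral_kernel_mul_le hu fun y =>
    (norm_regularKernel_le hκ x y).trans_eq (div_eq_mul_inv _ _)

/-- The available bound on the integrand grows with `x`; dividing by `1 + |x|` makes it uniform, so
dominated convergence applies, and the factor is then restored. -/
theorem IsWeight.continuous_regularOp (hW : IsWeight W) (hκ : 0 ≤ κ.re) (hu : LinearGrowth S u) :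
    Continuous (regularOp W κ u) := by
  have hpos : ∀ x : ℝ, (0 : ℝ) < 1 + |x| := fun x => one_pos.trans_le (one_le_one_add_abs x)
  have hinv : Continuous fun x : ℝ => (((1 + |x|)⁻¹ : ℝ) : ℂ) :=
    Complex.continuous_ofReal.comp ((by fun_prop : Continuous fun x : ℝ => 1 + |x|).inv₀
      fun x => (hpos x).ne')
  have h : Continuous fun x => ∫ y, (((1 + |x|)⁻¹ : ℝ) : ℂ) *
      (regularKernel κ x y * (W y * u y)) := by
    refine continuous_of_dominated (bound := fun y => 2⁻¹ * S * ((1 + |y|) ^ 2 * W y))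
      (fun x => ((hW.integrable_regularKernel_mul hκ hu x).const_mul _).1)
      (fun x => Eventually.of_forall fun y => ?_)
      (hW.integrable_moment.const_mul _)
      (Eventually.of_forall fun y => hinv.mul
        ((continuous_regularKernel_left κ y).mul continuous_const))
    have := hW.norm_kernel_mul_le hu
      ((norm_regularKernel_le hκ x y).trans_eq (div_eq_mul_inv _ _))
    rw [norm_mul, Complex.norm_real, Real.norm_of_nonneg (inv_nonneg.2 (hpos x).le),
      inv_mul_le_iff₀ (hpos x)]
    linarith
  have e : regularOp W κ u = fun x => ((1 + |x| : ℝ) : ℂ) * ∫ y, (((1 + |x|)⁻¹ : ℝ) : ℂ) *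
      (regularKernel κ x y * (W y * u y)) := by
    funext x
    rw [integral_const_mul, ← mul_assoc, ← Complex.ofReal_mul, mul_inv_cancel₀ (hpos x).ne',
      Complex.ofReal_one, one_mul, regularOp]
  rw [e]
  exact (by fun_prop : Continuous fun x : ℝ => ((1 + |x| : ℝ) : ℂ)).mul h

theorem IsWeight.linearGrowth_regularOp (hW : IsWeight W) (hκ : 0 ≤ κ.re)
    (hu : LinearGrowth S u) : LinearGrowth (2⁻¹ * S * moment W) (regularOp W κ u) :=
  ⟨hW.continuous_regularOp hκ hu, hW.norm_regularOp_le hκ hu⟩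

theorem IsWeight.norm_regularOp_sub_le (hW : IsWeight W) {κ' : ℂ} {c D S' : ℝ} {u' : ℝ → ℂ}
    (hc : 0 < c) (hκ : c ≤ κ.re) (hκ' : c ≤ κ'.re) (hu : LinearGrowth S u)
    (hu' : LinearGrowth S' u') (hD : LinearGrowth D (fun x => u x - u' x)) (x : ℝ) :
    ‖regularOp W κ u x - regularOp W κ' u' x‖ ≤
      (2⁻¹ * D + ‖κ - κ'‖ / c * S') * moment W * (1 + |x|) := by
  have i1 := hW.integrable_regularKernel_mul (hc.le.trans hκ) hu x
  have i2 := hW.integrable_regularKernel_mul (hc.le.trans hκ) hu' x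
  have i3 := hW.integrable_regularKernel_mul (hc.le.trans hκ') hu' x
  have e : regularOp W κ u x - regularOp W κ' u' x = regularOp W κ (fun x => u x - u' x) x +
      ∫ y, (regularKernel κ x y - regularKernel κ' x y) * (W y * u' y) := by
    simp only [regularOp, mul_sub, sub_mul]
    rw [integral_sub i1 i2, integral_sub i2 i3]; ring
  have b2 := hW.norm_integral_kernel_mul_le hu' (x := x) (B := ‖κ - κ'‖ / c)
    (k := fun y => regularKernel κ x y - regularKernel κ' x y) fun y =>
      (norm_regularKernel_sub_le hc hκ hκ' x y).trans_eq (by ring)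
  rw [e]
  refine (norm_add_le _ _).trans ((add_le_add (hW.norm_regularOp_le (hc.le.trans hκ) hD x)
    b2).trans_eq (by ring))

end Weight

/-! ### The weighted sup norm -/

open scoped BoundedContinuousFunction

/-- The function of linear growth associated to a bounded continuous function. -/
noncomputable def growthLift (v : ℝ →ᵇ ℂ) (x : ℝ) : ℂ := ((1 + |x| : ℝ) : ℂ) * v x

theorem one_add_abs_pos (x : ℝ) : 0 < 1 + |x| := one_pos.trans_le (one_le_one_add_abs x)

theorem one_add_abs_ne_zero (x : ℝ) : ((1 + |x| : ℝ) : ℂ) ≠ 0 :=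
  Complex.ofReal_ne_zero.2 (one_add_abs_pos x).ne'

theorem norm_growthLift (v : ℝ →ᵇ ℂ) (x : ℝ) : ‖growthLift v x‖ = (1 + |x|) * ‖v x‖ := by
  rw [growthLift, norm_mul, Complex.norm_real, Real.norm_of_nonneg (one_add_abs_pos x).le]

theorem linearGrowth_growthLift (v : ℝ →ᵇ ℂ) : LinearGrowth ‖v‖ (growthLift v) := by
  refine ⟨(by fun_prop : Continuous fun x : ℝ => ((1 + |x| : ℝ) : ℂ)).mul v.continuous,
    fun x => ?_⟩
  rw [norm_growthLift, mul_comm]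
  exact mul_le_mul_of_nonneg_right (v.norm_coe_le_norm x) (one_add_abs_pos x).le

theorem growthLift_sub (v v' : ℝ →ᵇ ℂ) (x : ℝ) :
    growthLift (v - v') x = growthLift v x - growthLift v' x := by
  simp [growthLift, mul_sub]

theorem growthLift_injective : Function.Injective growthLift := fun v v' h => by
  ext x
  exact mul_left_cancel₀ (one_add_abs_ne_zero x) (congrFun h x)

theorem norm_le_of_growthLift {v : ℝ →ᵇ ℂ} {S : ℝ} (h : ∀ x, ‖growthLift v x‖ ≤ S * (1 + |x|)) :
    ‖v‖ ≤ S := by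
  have h1 : ∀ x, ‖v x‖ ≤ S := fun x => by
    have := h x
    rw [norm_growthLift, mul_comm] at this
    exact le_of_mul_le_mul_right this (one_add_abs_pos x)
  exact (v.norm_le ((norm_nonneg _).trans (h1 0))).2 h1

/-- Puts functions of linear growth into a Banach space, where the contraction principle is
available. -/
theorem LinearGrowth.exists_growthLift_eq {S : ℝ} {u : ℝ → ℂ} (hu : LinearGrowth S u) :
    ∃ v : ℝ →ᵇ ℂ, growthLift v = u := by
  have hc : Continuous fun x : ℝ => (((1 + |x| : ℝ) : ℂ))⁻¹ * u x :=
    ((by fun_prop : Continuous fun x : ℝ => ((1 + |x| : ℝ) : ℂ)).inv₀ one_add_abs_ne_zero).mul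
      hu.continuous
  refine ⟨BoundedContinuousFunction.ofNormedAddCommGroup _ hc S fun x => ?_, funext fun x => ?_⟩
  · rw [norm_mul, norm_inv, Complex.norm_real, Real.norm_of_nonneg (one_add_abs_pos x).le,
      inv_mul_le_iff₀ (one_add_abs_pos x), mul_comm]
    exact hu.norm_le x
  · simp only [growthLift, BoundedContinuousFunction.coe_ofNormedAddCommGroup]
    rw [mul_inv_cancel_left₀ (one_add_abs_ne_zero x)]

/-! ### The contraction argument for normalized solutions -/

/-- The coupling constant is small compared to the moments of the weight. -/
structure IsSmall (W : ℝ → ℝ) (lam : ℝ) : Prop where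
  pos : 0 < lam
  integral_pos : 0 < ∫ x, W x
  mul_moment_le : lam * moment W ≤ 1 / 2
  mul_moment_sq_le : 16 * lam * moment W ^ 2 ≤ ∫ x, W x

/-- The square root of minus the energy that is forced by a normalized solution. -/
noncomputable def decayRate (W : ℝ → ℝ) (lam : ℝ) (u : ℝ → ℂ) : ℂ :=
  lam / 2 * ∫ y, (W y : ℂ) * u y

/-- The Birman-Schwinger equation for eigenfunctions `u` normalized by `lam ∫ W u = 2 κ`. -/
structure IsNormalizedSolution (W : ℝ → ℝ) (lam : ℝ) (κ : ℂ) (u : ℝ → ℂ) : Prop where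
  decayRate_eq : decayRate W lam u = κ
  eq : ∀ x, u x = 1 + lam * regularOp W κ u x

section

variable {W : ℝ → ℝ} {lam : ℝ}

theorem linearGrowth_one : LinearGrowth 1 (fun _ => (1 : ℂ)) :=
  ⟨continuous_const, fun x => by simp⟩

theorem IsSmall.moment_pos (hW : IsWeight W) (h : IsSmall W lam) : 0 < moment W :=
  h.integral_pos.trans_le hW.integral_le_moment

theorem decayRate_one (W : ℝ → ℝ) (lam : ℝ) :
    decayRate W lam (fun _ => 1) = ((lam / 2 * ∫ x, W x : ℝ) : ℂ) := by
  simp only [decayRate, mul_one]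
  rw [integral_complex_ofReal]; push_cast; ring

theorem IsWeight.norm_decayRate_sub_le (hW : IsWeight W) (hlam : 0 < lam) {S S' D : ℝ}
    {u u' : ℝ → ℂ} (hu : LinearGrowth S u) (hu' : LinearGrowth S' u')
    (hD : LinearGrowth D (fun x => u x - u' x)) :
    ‖decayRate W lam u - decayRate W lam u'‖ ≤ lam / 2 * (D * moment W) := by
  have e : decayRate W lam u - decayRate W lam u' =
      ((lam / 2 : ℝ) : ℂ) * ∫ y, (W y : ℂ) * (u y - u' y) := by
    simp only [decayRate, mul_sub]
    rw [integral_sub (hW.integrable_mul hu) (hW.integrable_mul hu')]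
    push_cast; ring
  rw [e, norm_mul, Complex.norm_real, Real.norm_of_nonneg (by positivity)]
  exact mul_le_mul_of_nonneg_left (hW.norm_integral_mul_le hD) (by positivity)

open Classical in
/-- The map whose fixed points are the normalized solutions. -/
noncomputable def fixedPointMap (W : ℝ → ℝ) (lam : ℝ) (v : ℝ →ᵇ ℂ) : ℝ →ᵇ ℂ :=
  if h : ∃ v' : ℝ →ᵇ ℂ, growthLift v' = fun x =>
    1 + lam * regularOp W (decayRate W lam (growthLift v)) (growthLift v) x then h.choose else 0

/-- When the decay rate has nonnegative real part the right side has linear growth, so the default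
value `0` is not taken. -/
theorem IsWeight.growthLift_fixedPointMap (hW : IsWeight W) {v : ℝ →ᵇ ℂ}
    (hre : 0 ≤ (decayRate W lam (growthLift v)).re) (x : ℝ) :
    growthLift (fixedPointMap W lam v) x =
      1 + lam * regularOp W (decayRate W lam (growthLift v)) (growthLift v) x := by
  set κ := decayRate W lam (growthLift v)
  have hg := hW.linearGrowth_regularOp hre (linearGrowth_growthLift v)
  have h : ∃ v' : ℝ →ᵇ ℂ, growthLift v' = fun x => 1 + lam * regularOp W κ (growthLift v) x := by
    refine LinearGrowth.exists_growthLift_eq (S := 1 + |lam| * (2⁻¹ * ‖v‖ * moment W))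
      ⟨continuous_const.add (continuous_const.mul hg.continuous), fun x => ?_⟩
    refine (norm_add_le _ _).trans ?_
    rw [norm_one, norm_mul, Complex.norm_real, Real.norm_eq_abs]
    have := mul_le_mul_of_nonneg_left (hg.norm_le x) (abs_nonneg lam)
    nlinarith [abs_nonneg x]
  have e : fixedPointMap W lam v = h.choose := dif_pos h
  rw [e, h.choose_spec]

/-- A closed ball that is mapped into itself by `fixedPointMap`. -/
def invariantSet (W : ℝ → ℝ) : Set (ℝ →ᵇ ℂ) :=
  {v | ∀ x, ‖growthLift v x - 1‖ ≤ (∫ x, W x) / (2 * moment W) * (1 + |x|)}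

theorem continuous_growthLift_apply (x : ℝ) : Continuous fun v : ℝ →ᵇ ℂ => growthLift v x :=
  continuous_const.mul (continuous_eval_const x)

theorem isClosed_invariantSet (W : ℝ → ℝ) : IsClosed (invariantSet W) := by
  simp only [invariantSet, Set.ofPred_forall]
  exact isClosed_iInter fun x =>
    isClosed_le ((continuous_growthLift_apply x).sub continuous_const).norm continuous_const

theorem IsSmall.linearGrowth_of_mem (hW : IsWeight W) (h : IsSmall W lam) {v : ℝ →ᵇ ℂ}
    (hv : v ∈ invariantSet W) : LinearGrowth (3 / 2) (growthLift v) := by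
  refine ⟨(linearGrowth_growthLift v).continuous, fun x => ?_⟩
  have h1 : (∫ x, W x) / (2 * moment W) ≤ 1 / 2 := by
    have := h.moment_pos hW
    rw [div_le_iff₀ (by positivity)]
    linarith [hW.integral_le_moment]
  have h2 : growthLift v x = 1 + (growthLift v x - 1) := by ring
  rw [h2]
  refine (norm_add_le _ _).trans ?_
  rw [norm_one]
  nlinarith [hv x, one_le_one_add_abs x, mul_le_mul_of_nonneg_right h1 (one_add_abs_pos x).le]

/-- With `A = ∫ W` and `m = moment W`, the radius `A/(2m)` of the invariant set is chosen for this
bound: the decay rate moves by at most `(λ/2) (A/(2m)) m = λA/4`, half its leading value, and so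
stays away from the imaginary axis. -/
theorem IsSmall.norm_decayRate_sub_le (hW : IsWeight W) (h : IsSmall W lam) {v : ℝ →ᵇ ℂ}
    (hv : v ∈ invariantSet W) :
    ‖decayRate W lam (growthLift v) - ((lam / 2 * ∫ x, W x : ℝ) : ℂ)‖ ≤
      lam / 4 * ∫ x, W x := by
  have hm := h.moment_pos hW
  have hu := linearGrowth_growthLift v
  rw [← decayRate_one]
  refine (hW.norm_decayRate_sub_le h.pos hu linearGrowth_one
    ⟨hu.continuous.sub continuous_const, hv⟩).trans_eq ?_
  field_simp; ring

theorem IsSmall.le_re_decayRate (hW : IsWeight W) (h : IsSmall W lam) {v : ℝ →ᵇ ℂ}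
    (hv : v ∈ invariantSet W) :
    lam / 4 * ∫ x, W x ≤ (decayRate W lam (growthLift v)).re := by
  have h1 := (Complex.abs_re_le_norm _).trans (h.norm_decayRate_sub_le hW hv)
  rw [Complex.sub_re, Complex.ofReal_re, abs_le] at h1
  linarith [h1.1]

theorem IsSmall.re_decayRate_pos (hW : IsWeight W) (h : IsSmall W lam) {v : ℝ →ᵇ ℂ}
    (hv : v ∈ invariantSet W) : 0 < (decayRate W lam (growthLift v)).re :=
  lt_of_lt_of_le (mul_pos (by linarith [h.pos]) h.integral_pos) (h.le_re_decayRate hW hv)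

theorem IsSmall.mapsTo_fixedPointMap (hW : IsWeight W) (h : IsSmall W lam) :
    Set.MapsTo (fixedPointMap W lam) (invariantSet W) (invariantSet W) := fun v hv x => by
  have hre := (h.re_decayRate_pos hW hv).le
  have hm := h.moment_pos hW
  rw [hW.growthLift_fixedPointMap hre, add_sub_cancel_left, norm_mul, Complex.norm_real,
    Real.norm_of_nonneg h.pos.le]
  refine (mul_le_mul_of_nonneg_left (hW.norm_regularOp_le hre (h.linearGrowth_of_mem hW hv) x)
    h.pos.le).trans ?_
  rw [← mul_assoc]
  refine mul_le_mul_of_nonneg_right ?_ (one_add_abs_pos x).le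
  -- What is needed is `3λm²/2 ≤ A`, with `A = ∫ W` and `m = moment W`.
  rw [le_div_iff₀ (by positivity)]
  nlinarith [h.mul_moment_sq_le, mul_nonneg h.pos.le (sq_nonneg (moment W))]

/-- With `A = ∫ W` and `m = moment W`, the kernel has Lipschitz constant `4/(λA)` in `κ`, while `κ`
moves by at most `λmD/2`. The product `2mD/A` is free of `λ`, so the prefactor `λ` makes the total
at most `(1/4 + 3/16) D`. -/
theorem IsSmall.dist_fixedPointMap_le (hW : IsWeight W) (h : IsSmall W lam) {v v' : ℝ →ᵇ ℂ}
    (hv : v ∈ invariantSet W) (hv' : v' ∈ invariantSet W) :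
    dist (fixedPointMap W lam v) (fixedPointMap W lam v') ≤ 1 / 2 * dist v v' := by
  have hm := h.moment_pos hW
  have hA := h.integral_pos
  have hl := h.pos
  rw [dist_eq_norm, dist_eq_norm]
  set D := ‖v - v'‖
  have hD : LinearGrowth D (fun x => growthLift v x - growthLift v' x) := by
    have := linearGrowth_growthLift (v - v')
    rwa [funext (growthLift_sub v v')] at this
  have hκ := h.le_re_decayRate hW hv
  have hκ' := h.le_re_decayRate hW hv'
  have hc : 0 < lam / 4 * ∫ x, W x := by positivity
  have hu := h.linearGrowth_of_mem hW hv
  have hu' := h.linearGrowth_of_mem hW hv'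
  refine norm_le_of_growthLift fun x => ?_
  rw [growthLift_sub, hW.growthLift_fixedPointMap (hc.le.trans hκ),
    hW.growthLift_fixedPointMap (hc.le.trans hκ'), add_sub_add_left_eq_sub, ← mul_sub, norm_mul,
    Complex.norm_real, Real.norm_of_nonneg hl.le]
  refine (mul_le_mul_of_nonneg_left (hW.norm_regularOp_sub_le hc hκ hκ' hu hu' hD x)
    hl.le).trans ?_
  rw [← mul_assoc]
  refine mul_le_mul_of_nonneg_right ?_ (one_add_abs_pos x).le
  have h1 : ‖decayRate W lam (growthLift v) - decayRate W lam (growthLift v')‖ /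
      (lam / 4 * ∫ x, W x) ≤ 2 * moment W * D / ∫ x, W x := by
    rw [div_le_div_iff₀ hc hA]
    have := mul_le_mul_of_nonneg_right (hW.norm_decayRate_sub_le hl hu hu' hD) hA.le
    nlinarith
  have hD0 : 0 ≤ D := norm_nonneg _
  have h2 : lam * moment W * (2 * moment W * D / ∫ x, W x) ≤ 1 / 8 * D := by
    rw [mul_div_assoc', div_le_iff₀ hA]
    nlinarith [mul_le_mul_of_nonneg_right h.mul_moment_sq_le hD0]
  have h3 := mul_le_mul_of_nonneg_right h.mul_moment_le hD0
  have h4 := mul_le_mul_of_nonneg_left h1 (mul_nonneg hl.le hm.le)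
  nlinarith

/-- An a priori bound: the equation gives `‖v‖ ≤ 1 + ‖v‖/4`, hence `‖v‖ ≤ 2`, and inserting this
back puts `v` near `1`. So uniqueness in the invariant set is uniqueness among all normalized
solutions of linear growth with `Re κ ≥ 0`. -/
theorem IsSmall.mem_invariantSet (hW : IsWeight W) (h : IsSmall W lam) {κ : ℂ} {v : ℝ →ᵇ ℂ}
    (hκ : 0 ≤ κ.re) (hv : IsNormalizedSolution W lam κ (growthLift v)) :
    (∀ x, ‖growthLift v x - 1‖ ≤ lam * moment W * (1 + |x|)) ∧ v ∈ invariantSet W := by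
  have hm := h.moment_pos hW
  have b : ∀ x, ‖growthLift v x - 1‖ ≤ lam * moment W * (‖v‖ / 2) * (1 + |x|) := fun x => by
    rw [hv.eq, add_sub_cancel_left, norm_mul, Complex.norm_real, Real.norm_of_nonneg h.pos.le]
    exact (mul_le_mul_of_nonneg_left (hW.norm_regularOp_le hκ (linearGrowth_growthLift v) x)
      h.pos.le).trans_eq (by ring)
  have hN : ‖v‖ ≤ 1 + ‖v‖ / 4 := norm_le_of_growthLift fun x => by
    have h2 : growthLift v x = 1 + (growthLift v x - 1) := by ring
    rw [h2]
    refine (norm_add_le _ _).trans ?_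
    rw [norm_one]
    have h3 := mul_le_mul_of_nonneg_right (mul_le_mul_of_nonneg_right h.mul_moment_le
      (by positivity : 0 ≤ ‖v‖ / 2)) (one_add_abs_pos x).le
    nlinarith [b x, one_le_one_add_abs x]
  have b' : ∀ x, ‖growthLift v x - 1‖ ≤ lam * moment W * (1 + |x|) := fun x => by
    refine (b x).trans (mul_le_mul_of_nonneg_right ?_ (one_add_abs_pos x).le)
    exact mul_le_of_le_one_right (mul_nonneg h.pos.le hm.le) (by linarith)
  refine ⟨b', fun x => (b' x).trans (mul_le_mul_of_nonneg_right ?_ (one_add_abs_pos x).le)⟩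
  rw [le_div_iff₀ (by positivity)]
  nlinarith [h.mul_moment_sq_le, mul_nonneg h.pos.le (sq_nonneg (moment W))]

theorem IsSmall.fixedPointMap_eq (hW : IsWeight W) {κ : ℂ} {v : ℝ →ᵇ ℂ}
    (hκ : 0 ≤ κ.re) (hv : IsNormalizedSolution W lam κ (growthLift v)) :
    fixedPointMap W lam v = v := by
  refine growthLift_injective (funext fun x => ?_)
  rw [hW.growthLift_fixedPointMap (by rwa [hv.decayRate_eq]), hv.decayRate_eq]
  exact (hv.eq x).symm

/-- Both solutions are fixed points of one contraction. Since `κ` is a function of `u`, solutions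
with different `κ` are compared directly. -/
theorem IsSmall.unique_normalizedSolution (hW : IsWeight W) (h : IsSmall W lam) {κ κ' : ℂ}
    {u u' : ℝ → ℂ} {S S' : ℝ} (hκ : 0 ≤ κ.re) (hκ' : 0 ≤ κ'.re)
    (hu : IsNormalizedSolution W lam κ u) (hu' : IsNormalizedSolution W lam κ' u')
    (hS : LinearGrowth S u) (hS' : LinearGrowth S' u') : κ = κ' ∧ u = u' := by
  obtain ⟨v, rfl⟩ := hS.exists_growthLift_eq
  obtain ⟨v', rfl⟩ := hS'.exists_growthLift_eq
  have hd := h.dist_fixedPointMap_le hW (h.mem_invariantSet hW hκ hu).2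
    (h.mem_invariantSet hW hκ' hu').2
  rw [IsSmall.fixedPointMap_eq hW hκ hu, IsSmall.fixedPointMap_eq hW hκ' hu'] at hd
  have hvv : v = v' := dist_le_zero.1 (by linarith)
  subst hvv
  exact ⟨hu.decayRate_eq.symm.trans hu'.decayRate_eq, rfl⟩

/-- The weight and the coupling are real. Combined with uniqueness, this forces `κ` to be real. -/
theorem IsNormalizedSolution.conj {κ : ℂ} {u : ℝ → ℂ} (hu : IsNormalizedSolution W lam κ u) :
    IsNormalizedSolution W lam (starRingEnd ℂ κ) (fun x => starRingEnd ℂ (u x)) := by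
  constructor
  · rw [← hu.decayRate_eq]
    simp only [decayRate, map_mul, map_div₀, Complex.conj_ofReal, ← integral_conj, map_ofNat]
  · intro x
    have hk : ∀ y, regularKernel (starRingEnd ℂ κ) x y = starRingEnd ℂ (regularKernel κ x y) :=
      fun y => by
        simp only [regularKernel, map_div₀, map_sub, map_mul, map_one, map_ofNat,
          ← Complex.exp_conj, map_neg, Complex.conj_ofReal]
    conv_lhs => rw [hu.eq x]
    simp only [regularOp, hk, map_add, map_mul, map_one, Complex.conj_ofReal, ← integral_conj]

theorem IsSmall.exists_normalizedSolution (hW : IsWeight W) (h : IsSmall W lam) :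
    ∃ κ : ℝ, ∃ u : ℝ → ℂ, 0 < κ ∧ (∃ S, LinearGrowth S u) ∧ IsNormalizedSolution W lam κ u ∧
      |κ - lam / 2 * ∫ x, W x| ≤ lam ^ 2 * moment W ^ 2 / 2 := by
  have hmaps := h.mapsTo_fixedPointMap hW
  have hcontr : ContractingWith (1 / 2) (hmaps.restrict _ _ _) := by
    refine ⟨by norm_num, LipschitzWith.of_dist_le_mul fun v v' => ?_⟩
    have := h.dist_fixedPointMap_le hW v.2 v'.2
    rw [Subtype.dist_eq, Subtype.dist_eq]
    simpa using this
  obtain ⟨v₀, hv₀⟩ := linearGrowth_one.exists_growthLift_eq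
  have hm := h.moment_pos hW
  have hmem : v₀ ∈ invariantSet W := fun x => by
    rw [hv₀, sub_self, norm_zero]
    exact mul_nonneg (div_nonneg h.integral_pos.le (by positivity)) (one_add_abs_pos x).le
  obtain ⟨v, hv, hfix, -, -⟩ := hcontr.exists_fixedPoint' (isClosed_invariantSet W).isComplete
    hmaps hmem (edist_ne_top _ _)
  have hre := h.re_decayRate_pos hW hv
  set κ := decayRate W lam (growthLift v) with hκdef
  have hsol : IsNormalizedSolution W lam κ (growthLift v) := by
    refine ⟨rfl, fun x => ?_⟩
    have := hW.growthLift_fixedPointMap hre.le x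
    rwa [hfix] at this
  have hg := linearGrowth_growthLift v
  have hgc : LinearGrowth ‖v‖ (fun x => starRingEnd ℂ (growthLift v x)) :=
    ⟨Complex.continuous_conj.comp hg.continuous, fun x => by
      rw [Complex.norm_conj]; exact hg.norm_le x⟩
  have hreal : starRingEnd ℂ κ = κ := (h.unique_normalizedSolution hW
    (by rw [Complex.conj_re]; exact hre.le) hre.le hsol.conj hsol hgc hg).1
  have hκre : ((κ.re : ℝ) : ℂ) = κ := Complex.conj_eq_iff_re.1 hreal
  refine ⟨κ.re, growthLift v, hre, ⟨_, hg⟩, by rwa [hκre], ?_⟩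
  -- The radius of the invariant set only bounds the error by `O(λ)`; the sharper deviation `λ *
  -- moment W` of a solution from `1` makes it `O(λ²)`.
  have h1 := hW.norm_decayRate_sub_le h.pos hg linearGrowth_one
    ⟨hg.continuous.sub continuous_const, (h.mem_invariantSet hW hre.le hsol).1⟩
  rw [decayRate_one] at h1
  have h2 := (Complex.abs_re_le_norm _).trans h1
  rw [Complex.sub_re, Complex.ofReal_re] at h2
  exact h2.trans_eq (by ring)

end

/-! ### From eigenfunctions to normalized solutions -/

theorem IsPrimitive.congr_ae {g h h' : ℝ → ℂ} (hg : IsPrimitive g h) (e : h =ᵐ[volume] h') :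
    IsPrimitive g h' :=
  ⟨fun a b => (hg.intervalIntegrable a b).congr_ae (ae_restrict_of_ae e), fun a b => by
    rw [hg.sub_eq]
    exact intervalIntegral.integral_congr_ae (e.mono fun x hx _ => hx)⟩

/-- Eigenfunctions are classical solutions of the eigenvalue equation. -/
theorem IsWeakImage.exists_solution {U w : ℝ → ℝ} (hU : ∀ᵐ x, U x = -w x) {z : ℂ} {ψ f : ℝ → ℂ}
    (hψ : LocallyIntegrable ψ volume) (hf : f =ᵐ[volume] fun x => z * ψ x)
    (h : IsWeakImage U ψ f) :
    ∃ f g : ℝ → ℂ, ψ =ᵐ[volume] f ∧ (∀ x, HasDerivAt f (g x) x) ∧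
      IsPrimitive g fun y => (-z - w y) * f y := by
  have hz : LocallyIntegrable (fun x => z * ψ x) volume := hψ.smul z
  have hh : LocallyIntegrable (fun x => (U x : ℂ) * ψ x - z * ψ x) volume := h.1.sub hz
  obtain ⟨f', g, h1, h2, h3⟩ := exists_regular_representative hψ hh fun φ hφ hc => by
    have e1 := h.2 φ hφ hc
    have e2 : ∫ x, φ x • f x = ∫ x, φ x • (z * ψ x) :=
      integral_congr_ae (hf.mono fun x hx => by simp only [hx])
    simp only [smul_sub]
    rw [integral_sub (integrable_smul_test h.1 hφ hc) (integrable_smul_test hz hφ hc), ← e2, ← e1]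
    ring
  refine ⟨f', g, h1, h2, h3.congr_ae ?_⟩
  filter_upwards [hU, h1] with x hx1 hx2
  rw [hx1, hx2]; push_cast; ring

section

variable {W : ℝ → ℝ} {lam : ℝ}

theorem IsWeight.integrable_abs_mul (hW : IsWeight W) : Integrable fun x => |x| * W x :=
  hW.integrable_moment.mono' (continuous_abs.aestronglyMeasurable.mul hW.integrable.1)
    (Eventually.of_forall fun x => by
      rw [Real.norm_of_nonneg (mul_nonneg (abs_nonneg x) (hW.nonneg x))]
      exact mul_le_mul_of_nonneg_right (by nlinarith [abs_nonneg x]) (hW.nonneg x))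

theorem IsWeight.integral_abs_mul_le (hW : IsWeight W) : ∫ x, |x| * W x ≤ moment W :=
  integral_mono hW.integrable_abs_mul hW.integrable_moment fun x =>
    mul_le_mul_of_nonneg_right (by nlinarith [abs_nonneg x]) (hW.nonneg x)

theorem IsWeight.regularOp_eq {S : ℝ} {u : ℝ → ℂ} (hW : IsWeight W) (hu : LinearGrowth S u)
    {κ : ℂ} (hκ : 0 ≤ κ.re) (x : ℝ) :
    regularOp W κ u x = ((∫ y, Complex.exp (-κ * ((|x - y| : ℝ) : ℂ)) * ((W y : ℂ) * u y)) -
      ∫ y, (W y : ℂ) * u y) / (2 * κ) := by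
  rw [← integral_sub (integrable_exp_abs_mul hκ (hW.integrable_mul hu) x) (hW.integrable_mul hu),
    ← integral_div, regularOp]
  congr 1; funext y
  rw [regularKernel]; ring

theorem regularOp_const_mul (c κ : ℂ) (u : ℝ → ℂ) (x : ℝ) :
    regularOp W κ (fun x => c * u x) x = c * regularOp W κ u x := by
  rw [regularOp, regularOp, ← integral_const_mul]
  congr 1; funext y; ring

theorem exists_sq_eq_re_nonneg (z : ℂ) : ∃ κ : ℂ, κ ^ 2 = z ∧ 0 ≤ κ.re := by
  obtain ⟨κ, hκ⟩ := IsAlgClosed.exists_pow_nat_eq z two_pos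
  rcases le_total 0 κ.re with h | h
  · exact ⟨κ, hκ, h⟩
  · exact ⟨-κ, by rw [neg_sq, hκ], by simpa using h⟩

/-- The linear operator `λ K` has norm at most `1/4`. This excludes eigenfunctions with `∫ W f = 0`,
which could not be normalized. -/
theorem IsSmall.eq_zero_of_eq_regularOp (hW : IsWeight W) (h : IsSmall W lam) {S : ℝ}
    {u : ℝ → ℂ} {κ : ℂ} (hκ : 0 ≤ κ.re) (hu : LinearGrowth S u)
    (e : ∀ x, u x = lam * regularOp W κ u x) (x : ℝ) : u x = 0 := by
  obtain ⟨v, rfl⟩ := hu.exists_growthLift_eq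
  have hN : ‖v‖ ≤ ‖v‖ / 4 := norm_le_of_growthLift fun x => by
    rw [e, norm_mul, Complex.norm_real, Real.norm_of_nonneg h.pos.le]
    refine (mul_le_mul_of_nonneg_left (hW.norm_regularOp_le hκ (linearGrowth_growthLift v) x)
      h.pos.le).trans ?_
    rw [← mul_assoc]
    refine mul_le_mul_of_nonneg_right ?_ (one_add_abs_pos x).le
    nlinarith [mul_le_mul_of_nonneg_right h.mul_moment_le (norm_nonneg v)]
  have hv : v = 0 := norm_le_zero_iff.1 (by linarith [norm_nonneg v])
  simp [hv, growthLift]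

/-- A nonzero square integrable solution of the eigenvalue equation is a multiple of a normalized
solution. -/
theorem IsSmall.exists_normalized (hW : IsWeight W) (h : IsSmall W lam) {z : ℂ} {f g : ℝ → ℂ}
    (hf : ∀ x, HasDerivAt f (g x) x)
    (hg : IsPrimitive g fun y => (-z - ((lam * W y : ℝ) : ℂ)) * f y)
    (hf2 : Integrable fun x => ‖f x‖ ^ 2) (hne : ∃ x, f x ≠ 0) :
    ∃ κ c : ℂ, ∃ S : ℝ, κ ^ 2 = -z ∧ 0 ≤ κ.re ∧ c ≠ 0 ∧ LinearGrowth S (fun x => c * f x) ∧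
      IsNormalizedSolution W lam κ (fun x => c * f x) := by
  obtain ⟨x₀, hx₀⟩ := hne
  have hl := h.pos
  obtain ⟨κ, hκz, hκ⟩ := exists_sq_eq_re_nonneg (-z)
  rw [← hκz] at hg
  have hw : Integrable fun x => lam * W x := hW.integrable.const_mul lam
  have hw0 : ∀ x, 0 ≤ lam * W x := fun x => mul_nonneg hl.le (hW.nonneg x)
  have hw1 : ∫ x, lam * W x ≤ 1 / 2 := by
    rw [integral_const_mul]
    exact (mul_le_mul_of_nonneg_left hW.integral_le_moment hl.le).trans h.mul_moment_le
  obtain ⟨S, hS⟩ := exists_norm_le_of_solution hf hg hf2 hw hw0 hw1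
  have hfc : Continuous f := continuous_iff_continuousAt.2 fun x => (hf x).continuousAt
  have hS0 : 0 ≤ S := (norm_nonneg _).trans (hS 0)
  have hgr : LinearGrowth S f := ⟨hfc, fun x => (hS x).trans
    (le_mul_of_one_le_right hS0 (one_le_one_add_abs x))⟩
  -- Imaginary `κ` corresponds to energies `z ≥ 0`.
  rcases hκ.eq_or_lt with hκ0 | hκ0
  · have e : ∀ x, |x| * (lam * W x) = lam * (|x| * W x) := fun x => by ring
    refine absurd (eq_zero_of_re_eq_zero hκ0.symm hf hg hf2 hS hw hw0 ?_ ?_ x₀) hx₀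
    · simp only [e]; exact hW.integrable_abs_mul.const_mul lam
    · simp only [e]
      rw [integral_const_mul]
      have := mul_le_mul_of_nonneg_left hW.integral_abs_mul_le hl.le
      linarith [h.mul_moment_le]
  have hκne : κ ≠ 0 := fun h0 => by simp [h0] at hκ0
  have hln : (lam : ℂ) ≠ 0 := Complex.ofReal_ne_zero.2 hl.ne'
  set a := ∫ y, (W y : ℂ) * f y with ha
  have ek : ∀ y, κ ^ 2 * f y - (κ ^ 2 - ((lam * W y : ℝ) : ℂ)) * f y = lam * (W y * f y) :=
    fun y => by push_cast; ring
  -- The resolvent equation, with the singular part `1/(2κ)` of the kernel split off as a constant.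
  have key : ∀ x, f x = lam * a / (2 * κ) + lam * regularOp W κ f x := fun x => by
    have h1 := integral_exp_abs_mul hκ0 hf hg hf2
      (by simp only [ek]; exact (hW.integrable_mul hgr).const_mul _) x
    simp only [ek, mul_left_comm _ (lam : ℂ)] at h1
    rw [integral_const_mul] at h1
    rw [hW.regularOp_eq hgr hκ x, ← ha]
    generalize ∫ y, Complex.exp (-κ * ((|x - y| : ℝ) : ℂ)) * ((W y : ℂ) * f y) = J at h1 ⊢
    field_simp
    linear_combination -h1
  have ha0 : a ≠ 0 := fun h0 => by
    refine hx₀ (h.eq_zero_of_eq_regularOp hW hκ hgr (fun x => ?_) x₀)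
    conv_lhs => rw [key x, h0]
    simp
  -- This factor turns the constant term of `key` into `1`.
  refine ⟨κ, 2 * κ / (lam * a), ‖2 * κ / (lam * a)‖ * S, hκz, hκ,
    div_ne_zero (mul_ne_zero two_ne_zero hκne) (mul_ne_zero hln ha0),
    ⟨continuous_const.mul hfc, fun x => ?_⟩, ?_, fun x => ?_⟩
  · rw [norm_mul, mul_assoc]
    exact mul_le_mul_of_nonneg_left (hgr.norm_le x) (norm_nonneg _)
  · simp only [decayRate, mul_left_comm _ (2 * κ / (lam * a))]
    rw [integral_const_mul, ← ha]
    field_simp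
  · rw [regularOp_const_mul]
    conv_lhs => rw [key x]
    field_simp

/-! ### From normalized solutions to eigenfunctions -/

theorem integrable_exp_neg_mul_abs {κ : ℝ} (hκ : 0 < κ) :
    Integrable fun x : ℝ => Real.exp (-κ * |x|) := by
  refine (integrable_inv_one_add_sq.const_mul (1 + 2 / κ ^ 2)).mono'
    (Continuous.aestronglyMeasurable (by fun_prop)) (Eventually.of_forall fun x => ?_)
  rw [Real.norm_of_nonneg (Real.exp_pos _).le, neg_mul, Real.exp_neg, ← div_eq_mul_inv,
    le_div_iff₀ (by positivity), inv_mul_le_iff₀ (Real.exp_pos _)]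
  have h1 := Real.quadratic_le_exp_of_nonneg (mul_nonneg hκ.le (abs_nonneg x))
  have h2 : (1 + κ ^ 2 * x ^ 2 / 2) * (1 + 2 / κ ^ 2) =
      1 + x ^ 2 + κ ^ 2 * x ^ 2 / 2 + 2 / κ ^ 2 := by field_simp; ring
  have h3 : 0 ≤ κ * |x| := by positivity
  have h4 : (κ * |x|) ^ 2 = κ ^ 2 * x ^ 2 := by rw [mul_pow, sq_abs]
  calc 1 + x ^ 2 ≤ (1 + κ ^ 2 * x ^ 2 / 2) * (1 + 2 / κ ^ 2) := by
        rw [h2]; have : 0 ≤ κ ^ 2 * x ^ 2 / 2 + 2 / κ ^ 2 := by positivity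
        linarith
    _ ≤ Real.exp (κ * |x|) * (1 + 2 / κ ^ 2) := by gcongr; linarith

/-- Normalized solutions satisfy the homogeneous Birman-Schwinger equation. -/
theorem IsNormalizedSolution.two_mul_eq {κ : ℂ} {u : ℝ → ℂ} {S : ℝ}
    (hW : IsWeight W) (hκ : 0 < κ.re) (hgr : LinearGrowth S u)
    (hu : IsNormalizedSolution W lam κ u) (x : ℝ) :
    2 * κ * u x = ∫ y, Complex.exp (-κ * ((|x - y| : ℝ) : ℂ)) * (lam * ((W y : ℂ) * u y)) := by
  have hκne : κ ≠ 0 := fun h0 => by simp [h0] at hκ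
  have h1 := hu.decayRate_eq
  rw [decayRate] at h1
  simp only [mul_left_comm _ (lam : ℂ)]
  rw [integral_const_mul, hu.eq x, hW.regularOp_eq hgr hκ.le x]
  field_simp
  linear_combination -2 * h1

/-- The function `2κu` is the convolution of the integrable function `λWu` with `exp(-κ|x|)`, hence
both integrable and bounded, and therefore square integrable. -/
theorem IsNormalizedSolution.memLp {κ : ℝ} {u : ℝ → ℂ} {S : ℝ}
    (hW : IsWeight W) (hκ : 0 < κ) (hgr : LinearGrowth S u)
    (hu : IsNormalizedSolution W lam κ u) : MemLp u 2 volume := by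
  set q : ℝ → ℂ := fun y => lam * ((W y : ℂ) * u y)
  have hq : Integrable q := (hW.integrable_mul hgr).const_mul _
  have hκc : (κ : ℂ) ≠ 0 := Complex.ofReal_ne_zero.2 hκ.ne'
  have he : ∀ x y : ℝ, Complex.exp (-(κ : ℂ) * ((|x - y| : ℝ) : ℂ)) =
      ((Real.exp (-κ * |x - y|) : ℝ) : ℂ) := fun x y => by push_cast; rfl
  have hconv := (Integrable.convolution_integrand (ContinuousLinearMap.mul ℝ ℂ) hq
    (integrable_exp_neg_mul_abs hκ).ofReal (μ := volume)).integral_prod_left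
  have h2 : ∀ x, 2 * (κ : ℂ) * u x = ∫ y, q y * ((Real.exp (-κ * |x - y|) : ℝ) : ℂ) := fun x => by
    rw [hu.two_mul_eq hW (by simpa using hκ) hgr x]
    simp only [he, q]
    congr 1; funext y; ring
  have hui : Integrable u := by
    refine (hconv.const_mul (2 * (κ : ℂ))⁻¹).congr (Eventually.of_forall fun x => ?_)
    simp only [ContinuousLinearMap.mul_apply']
    have := h2 x
    rw [inv_mul_eq_iff_eq_mul₀ (mul_ne_zero two_ne_zero hκc)]
    exact this.symm
  have hub : ∀ x, ‖u x‖ ≤ (2 * κ)⁻¹ * ∫ y, ‖q y‖ := fun x => by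
    rw [le_inv_mul_iff₀ (by positivity)]
    have e : 2 * κ * ‖u x‖ = ‖2 * (κ : ℂ) * u x‖ := by
      rw [norm_mul, norm_mul, Complex.norm_two, Complex.norm_real, Real.norm_of_nonneg hκ.le]
    rw [e, h2 x]
    refine norm_integral_le_of_norm_le hq.norm (Eventually.of_forall fun y => ?_)
    rw [norm_mul, Complex.norm_real, Real.norm_of_nonneg (Real.exp_pos _).le]
    refine mul_le_of_le_one_right (norm_nonneg _) (Real.exp_le_one_iff.2 ?_)
    nlinarith [mul_nonneg hκ.le (abs_nonneg (x - y))]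
  rw [memLp_two_iff_integrable_sq_norm hui.1]
  refine (hui.norm.const_mul ((2 * κ)⁻¹ * ∫ y, ‖q y‖)).mono' (hui.1.norm.pow 2)
    (Eventually.of_forall fun x => ?_)
  rw [Real.norm_of_nonneg (sq_nonneg _), sq]
  exact mul_le_mul_of_nonneg_right (hub x) (norm_nonneg _)

theorem isPrimitive_deriv_test {φ : ℝ → ℝ} (hφ : ContDiff ℝ ∞ φ) :
    IsPrimitive (fun x => ((deriv φ x : ℝ) : ℂ)) (fun x => ((iteratedDeriv 2 φ x : ℝ) : ℂ)) := by
  have hc : Continuous fun x => ((iteratedDeriv 2 φ x : ℝ) : ℂ) :=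
    Complex.continuous_ofReal.comp
      (hφ.continuous_iteratedDeriv 2 (WithTop.coe_le_coe.2 le_top))
  refine ⟨fun a b => hc.intervalIntegrable a b, fun a b => ?_⟩
  refine (intervalIntegral.integral_eq_sub_of_hasDerivAt
    (f := fun x => ((deriv φ x : ℝ) : ℂ)) (fun x _ => ?_)
    (hc.intervalIntegrable a b)).symm
  rw [iteratedDeriv_succ, iteratedDeriv_one]
  exact (((contDiff_infty_iff_deriv.1 hφ).2.differentiable (by simp)) x).hasDerivAt.ofReal_comp

/-- Normalized solutions are eigenfunctions. -/
theorem IsNormalizedSolution.isWeakImage {U : ℝ → ℝ} (hU : ∀ᵐ x, U x = -(lam * W x)) {κ : ℝ}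
    {u : ℝ → ℂ} {S : ℝ} (hW : IsWeight W) (hκ : 0 < κ) (hgr : LinearGrowth S u)
    (hu : IsNormalizedSolution W lam κ u) :
    IsWeakImage U u (fun x => -(κ : ℂ) ^ 2 * u x) := by
  set q : ℝ → ℂ := fun y => lam * ((W y : ℂ) * u y)
  have hq : Integrable q := (hW.integrable_mul hgr).const_mul _
  have hκc : (κ : ℂ) ≠ 0 := Complex.ofReal_ne_zero.2 hκ.ne'
  have hκre : 0 < (κ : ℂ).re := by simpa using hκ
  have hUq : (fun x => (U x : ℂ) * u x) =ᵐ[volume] fun x => -q x := by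
    filter_upwards [hU] with x hx
    simp only [q, hx]; push_cast; ring
  refine ⟨(hq.neg.congr hUq.symm).locallyIntegrable, fun φ hφ hc => ?_⟩
  have hul : LocallyIntegrable u volume := hgr.continuous.locallyIntegrable
  have hφ2c : Continuous (iteratedDeriv 2 φ) :=
    hφ.continuous_iteratedDeriv 2 (WithTop.coe_le_coe.2 le_top)
  have hφ2s : HasCompactSupport (iteratedDeriv 2 φ) := by
    rw [iteratedDeriv_succ, iteratedDeriv_one]; exact hc.deriv.deriv
  have hφi : Integrable fun x => (φ x : ℂ) :=
    (hφ.continuous.integrable_of_hasCompactSupport hc).ofReal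
  have hφ2i : Integrable fun x => ((iteratedDeriv 2 φ x : ℝ) : ℂ) :=
    (hφ2c.integrable_of_hasCompactSupport hφ2s).ofReal
  set k : ℝ → ℂ := fun x => (κ : ℂ) ^ 2 * φ x - ((iteratedDeriv 2 φ x : ℝ) : ℂ)
  have hk : Integrable k := (hφi.const_mul _).sub hφ2i
  have hφsq : Integrable fun x => ‖(φ x : ℂ)‖ ^ 2 := by
    refine Continuous.integrable_of_hasCompactSupport (by have := hφ.continuous; fun_prop) ?_
    refine hc.mono fun x hx => ?_
    rw [Function.mem_support] at hx ⊢
    rintro h0; simp [h0] at hx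
  -- The resolvent formula is applied to the test function, so no derivative of `u` is needed;
  -- symmetry of the kernel and Fubini move it onto `u` in `main`.
  have hrep : ∀ y, ∫ x, Complex.exp (-(κ : ℂ) * ((|y - x| : ℝ) : ℂ)) * k x = 2 * κ * φ y :=
    integral_exp_abs_mul hκre
      (fun x => ((hφ.differentiable (by simp)) x).hasDerivAt.ofReal_comp)
      (isPrimitive_deriv_test hφ) hφsq hk
  have hF : Integrable (Function.uncurry fun x y : ℝ =>
      Complex.exp (-(κ : ℂ) * ((|x - y| : ℝ) : ℂ)) * (k x * q y)) (volume.prod volume) := by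
    refine (hk.mul_prod hq).bdd_mul (c := 1) (Continuous.aestronglyMeasurable (by fun_prop))
      (Eventually.of_forall fun p => norm_cexp_neg_mul_le hκre.le (abs_nonneg _))
  have main : ∫ x, k x * u x = ∫ x, φ x * q x := by
    have e1 : ∀ x, 2 * (κ : ℂ) * (k x * u x) =
        ∫ y, Complex.exp (-(κ : ℂ) * ((|x - y| : ℝ) : ℂ)) * (k x * q y) := fun x => by
      rw [mul_left_comm, hu.two_mul_eq hW hκre hgr x, ← integral_const_mul]
      congr 1; funext y; simp only [q]; ring
    have e2 : ∀ y, ∫ x, Complex.exp (-(κ : ℂ) * ((|x - y| : ℝ) : ℂ)) * (k x * q y) =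
        2 * (κ : ℂ) * (φ y * q y) := fun y => by
      rw [← mul_assoc, ← hrep y, ← integral_mul_const]
      congr 1; funext x; rw [abs_sub_comm]; ring
    refine mul_left_cancel₀ (mul_ne_zero two_ne_zero hκc) ?_
    rw [← integral_const_mul, ← integral_const_mul]
    simp only [e1, ← e2]
    exact integral_integral_swap hF
  have i1 := integrable_smul_test₂ hul hφ hc
  have i2 := integrable_smul_test hul hφ hc
  have e3 : ∫ x, k x * u x = (κ : ℂ) ^ 2 * (∫ x, φ x • u x) -
      ∫ x, iteratedDeriv 2 φ x • u x := by
    rw [← integral_const_mul, ← integral_sub (i2.const_mul _) i1]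
    congr 1; funext x
    simp only [k, Complex.real_smul]; ring
  have e4 : ∫ x, φ x • ((U x : ℂ) * u x) = -∫ x, φ x * q x := by
    rw [← integral_neg]
    refine integral_congr_ae (hUq.mono fun x hx => ?_)
    simp only [hx, Complex.real_smul]; ring
  have e5 : ∫ x, φ x • (-(κ : ℂ) ^ 2 * u x) = -(κ : ℂ) ^ 2 * ∫ x, φ x • u x := by
    rw [← integral_const_mul]
    congr 1; funext x
    simp only [Complex.real_smul]; ring
  rw [e4, e5, ← main, e3]; ring

end

/-! ### Point spectrum and multiplicity -/

section Spectrum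

variable {U : ℝ → ℝ} {z : ℂ}

theorem mem_pointSpectrum_iff :
    z ∈ pointSpectrum (schrodingerOperator U) ↔
      ∃ ψ : L2R, ψ ≠ 0 ∧ IsWeakImage U ψ (z • ψ : L2R) := by
  have hinj : z ∈ pointSpectrum (schrodingerOperator U) ↔
      ¬ ∀ y, subScalar (schrodingerOperator U) z y = 0 → y = 0 :=
    not_congr (injective_iff_map_eq_zero _)
  rw [hinj]
  push Not
  constructor
  · rintro ⟨y, hy, hne⟩
    exact ⟨y, fun h0 => hne (Subtype.ext h0),
      exists_schrodingerOperator_apply_eq_iff.1 ⟨y.2, sub_eq_zero.1 hy⟩⟩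
  · rintro ⟨ψ, hne, h⟩
    obtain ⟨hmem, e⟩ := exists_schrodingerOperator_apply_eq_iff.2 h
    exact ⟨⟨ψ, hmem⟩, sub_eq_zero.2 e, fun h0 => hne (congrArg Subtype.val h0)⟩

theorem multiplicity_eq_one {ψ₀ : L2R} (h0 : ψ₀ ≠ 0) (h : IsWeakImage U ψ₀ (z • ψ₀ : L2R))
    (huniq : ∀ ψ : L2R, IsWeakImage U ψ (z • ψ : L2R) → ∃ c : ℂ, c • ψ₀ = ψ) :
    multiplicity (schrodingerOperator U) z = 1 := by
  obtain ⟨hmem, e⟩ := exists_schrodingerOperator_apply_eq_iff.2 h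
  refine rank_eq_one (⟨⟨ψ₀, hmem⟩, LinearMap.mem_ker.2 (sub_eq_zero.2 e)⟩ :
    LinearMap.ker (subScalar (schrodingerOperator U) z))
    (fun hz => h0 (congrArg (fun y => (y.1.1 : L2R)) hz)) fun y => ?_
  obtain ⟨c, hc⟩ := huniq y.1.1 (exists_schrodingerOperator_apply_eq_iff.1
    ⟨y.1.2, sub_eq_zero.1 (LinearMap.mem_ker.1 y.2)⟩)
  exact ⟨c, Subtype.ext (Subtype.ext hc)⟩

end Spectrum

/-- For small coupling, the operator has exactly one eigenvalue, which is simple. -/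
theorem IsSmall.exists_eigenvalue {W U : ℝ → ℝ} {lam : ℝ} (hW : IsWeight W) (h : IsSmall W lam)
    (hU : ∀ᵐ x, U x = -(lam * W x)) :
    ∃ κ : ℝ, pointSpectrum (schrodingerOperator U) = {((-κ ^ 2 : ℝ) : ℂ)} ∧
      multiplicity (schrodingerOperator U) ((-κ ^ 2 : ℝ) : ℂ) = 1 ∧
      |κ - lam / 2 * ∫ x, W x| ≤ lam ^ 2 * moment W ^ 2 / 2 := by
  obtain ⟨κ, u, hκ, ⟨S, hgr⟩, hu, hκe⟩ := h.exists_normalizedSolution hW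
  have hκc : (κ : ℂ) ≠ 0 := Complex.ofReal_ne_zero.2 hκ.ne'
  have hmem := hu.memLp hW hκ hgr
  set ψ₀ : L2R := hmem.toLp u
  have hψ₀ : ψ₀ =ᵐ[volume] u := hmem.coeFn_toLp
  -- If `u` vanished almost everywhere, then `κ = (λ/2) ∫ W u` would be zero.
  have h0 : ψ₀ ≠ 0 := fun hz => by
    have hu0 : u =ᵐ[volume] 0 := hψ₀.symm.trans (by rw [hz]; exact Lp.coeFn_zero ..)
    have h1 := hu.decayRate_eq
    rw [decayRate, integral_eq_zero_of_ae (hu0.mono fun x hx => by simp [hx]), mul_zero] at h1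
    exact hκc h1.symm
  have hweak : IsWeakImage U ψ₀ (((-κ ^ 2 : ℝ) : ℂ) • ψ₀ : L2R) := by
    refine (hu.isWeakImage hU hW hκ hgr).congr hψ₀.symm ?_
    filter_upwards [hψ₀, Lp.coeFn_smul ((-κ ^ 2 : ℝ) : ℂ) ψ₀] with x h1 h2
    rw [h2, Pi.smul_apply, h1, smul_eq_mul]; push_cast; rfl
  -- The energy is an arbitrary complex number here, so non-real eigenvalues are excluded without
  -- using self-adjointness.
  have huniq : ∀ (z : ℂ) (ψ : L2R), ψ ≠ 0 → IsWeakImage U ψ (z • ψ : L2R) →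
      z = ((-κ ^ 2 : ℝ) : ℂ) ∧ ∃ c : ℂ, c • ψ₀ = ψ := fun z ψ hne hψ => by
    obtain ⟨f, g, hf, hfd, hg⟩ := hψ.exists_solution hU ψ.locallyIntegrable
      (Lp.coeFn_smul z ψ)
    have hf2 : Integrable fun x => ‖f x‖ ^ 2 :=
      ((memLp_two_iff_integrable_sq_norm (Lp.aestronglyMeasurable ψ)).1 (Lp.memLp ψ)).congr
        (hf.mono fun x hx => by simp only [hx])
    have hfne : ∃ x, f x ≠ 0 := by
      by_contra! hz
      exact hne (Lp.ext (by
        filter_upwards [hf, Lp.coeFn_zero ℂ 2 (volume : Measure ℝ)] with x h1 h2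
        rw [h1, h2, hz]; rfl))
    obtain ⟨κ', c, S', hκ', hre, hc, hgr', hsol⟩ := h.exists_normalized hW hfd hg hf2 hfne
    obtain ⟨rfl, e⟩ := h.unique_normalizedSolution hW hre (by simpa using hκ.le) hsol hu hgr' hgr
    refine ⟨by push_cast; rw [hκ', neg_neg], c⁻¹, Lp.ext ?_⟩
    filter_upwards [hf, hψ₀, Lp.coeFn_smul c⁻¹ ψ₀] with x h1 h2 h3
    rw [h3, Pi.smul_apply, h2, h1, smul_eq_mul, ← congrFun e x, inv_mul_cancel_left₀ hc]
  refine ⟨κ, ?_, multiplicity_eq_one h0 hweak fun ψ hψ => ?_, hκe⟩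
  · refine Set.eq_singleton_iff_unique_mem.2 ⟨mem_pointSpectrum_iff.2 ⟨ψ₀, h0, hweak⟩,
      fun z hz => ?_⟩
    obtain ⟨ψ, hne, hψ⟩ := mem_pointSpectrum_iff.1 hz
    exact (huniq z ψ hne hψ).1
  · by_cases hne : ψ = 0
    · exact ⟨0, by rw [hne, zero_smul]⟩
    · exact (huniq _ ψ hne hψ).2

/-! ### The potential as a weight, and the asymptotic expansion -/

theorem isWeight_abs {V : ℝ → ℝ} (hV : Integrable V volume)
    (hVmom : Integrable (fun x : ℝ => (1 + x ^ 2) * |V x|) volume) : IsWeight fun x => |V x| := by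
  refine ⟨fun x => abs_nonneg _, hV.abs, (hVmom.const_mul 2).mono'
    ((Continuous.aestronglyMeasurable (by fun_prop)).mul hV.abs.1)
    (Eventually.of_forall fun x => ?_)⟩
  rw [Real.norm_of_nonneg (by positivity), ← mul_assoc]
  refine mul_le_mul_of_nonneg_right ?_ (abs_nonneg _)
  -- This is `(1 + |x|)² ≤ 2 (1 + x²)`.
  nlinarith [sq_nonneg (|x| - 1), sq_abs x]

theorem integral_abs_pos {V : ℝ → ℝ} (hV : Integrable V volume) (hV0 : ¬ V =ᵐ[volume] 0) :
    0 < ∫ x, |V x| := by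
  refine (integral_nonneg fun x => abs_nonneg _).lt_of_ne fun h => hV0 ?_
  have := (integral_eq_zero_iff_of_nonneg (fun x => abs_nonneg _) hV.abs).1 h.symm
  exact this.mono fun x hx => abs_eq_zero.1 hx

end Schrodinger

theorem mainTheorem1 (V : ℝ → ℝ) (hV : Integrable V volume) (hV0 : ¬ V =ᵐ[volume] 0)
    (hVneg : ∀ᵐ x ∂volume, V x ≤ 0)
    (hVmom : Integrable (fun x : ℝ => (1 + x ^ 2) * |V x|) volume) :
    ∃ lam₀ : ℝ, 0 < lam₀ ∧ ∃ E : ℝ → ℝ,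
      (∀ lam ∈ Set.Ioo 0 lam₀,
        Schrodinger.pointSpectrum (Schrodinger.schrodingerOperator fun x => lam * V x)
            = {(E lam : ℂ)} ∧
          Schrodinger.multiplicity (Schrodinger.schrodingerOperator fun x => lam * V x)
            (E lam : ℂ) = 1) ∧
      (fun lam : ℝ => E lam - (-(lam ^ 2 / 4) * (∫ x, |V x|) ^ 2))
        =O[𝓝[>] (0 : ℝ)] fun lam : ℝ => lam ^ 3 := by
  have hW := Schrodinger.isWeight_abs hV hVmom
  have hA := Schrodinger.integral_abs_pos hV hV0
  have hm : 0 < Schrodinger.moment fun x => |V x| := hA.trans_le hW.integral_le_moment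
  set A := ∫ x, |V x|
  set m := Schrodinger.moment fun x => |V x|
  -- The two terms encode the two smallness conditions `λm ≤ 1/2` and `16λm² ≤ A`.
  set lam₀ := min (1 / (2 * m)) (A / (16 * m ^ 2))
  have hlam₀ : 0 < lam₀ := lt_min (by positivity) (by positivity)
  have hsmall : ∀ lam ∈ Set.Ioo 0 lam₀, Schrodinger.IsSmall (fun x => |V x|) lam := by
    rintro lam ⟨h0, h1⟩
    have h2 := (lt_div_iff₀ (by positivity)).1 (h1.trans_le (min_le_left _ _))
    have h3 := (lt_div_iff₀ (by positivity)).1 (h1.trans_le (min_le_right _ _))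
    exact ⟨h0, hA, by linarith, by linarith⟩
  have key : ∀ lam ∈ Set.Ioo 0 lam₀, ∃ κ : ℝ, _ := fun lam hlam =>
    (hsmall lam hlam).exists_eigenvalue hW (U := fun x => lam * V x)
      (hVneg.mono fun x hx => by rw [abs_of_nonpos hx]; ring)
  choose! κ hspec hmult hκ using key
  refine ⟨lam₀, hlam₀, fun lam => -κ lam ^ 2, fun lam hlam => ⟨hspec lam hlam, hmult lam hlam⟩, ?_⟩
  -- By the difference of squares, the constant is the product of `|κ - λA/2| ≤ λ²m²/2` and `|κ +
  -- λA/2| ≤ 2λA`.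
  refine Asymptotics.IsBigO.of_bound (m ^ 2 * A) ?_
  filter_upwards [Ioo_mem_nhdsGT hlam₀] with lam hlam
  have h0 := hlam.1
  have h1 := hκ lam hlam
  have h2 := (hsmall lam hlam).mul_moment_sq_le
  change |κ lam - lam / 2 * A| ≤ lam ^ 2 * m ^ 2 / 2 at h1
  change 16 * lam * m ^ 2 ≤ A at h2
  have e : -κ lam ^ 2 - -(lam ^ 2 / 4) * A ^ 2 =
      -((κ lam - lam / 2 * A) * ((κ lam - lam / 2 * A) + lam * A)) := by ring
  rw [e, norm_neg, norm_mul, Real.norm_eq_abs, Real.norm_eq_abs, Real.norm_of_nonneg (by positivity)]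
  have h3 : |κ lam - lam / 2 * A + lam * A| ≤ 2 * (lam * A) := by
    refine (abs_add_le _ _).trans ?_
    rw [abs_of_nonneg (by positivity : 0 ≤ lam * A)]
    have := mul_le_mul_of_nonneg_left h2 h0.le
    nlinarith [mul_pos h0 hA]
  calc _ ≤ lam ^ 2 * m ^ 2 / 2 * (2 * (lam * A)) := mul_le_mul h1 h3 (abs_nonneg _) (by positivity)
    _ = _ := by ring
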